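/- Let $(\varepsilon_p)_{p\text{ prime}}$ be independent random variables taking the values $+1$ and $-1$ with probability $1/2$ each, and let $f(n)=\prod_{p^k\| n}\varepsilon_p^{k}$ $(n\ge 1)$ be the associated random completely multiplicative function. There is an absolute constant $C_0>0$ such that for every constant $C\ge C_0$ there is a constant $K>0$, depending only on $C$, with the following property. For all real numbers $x>e^{e}$ and $0<y\le x$, and all even integers $q\ge 0$, $$\mathbb{E}\Big[\Big(\sum_{n\le x}f(n)\Big)^{q}\Big]\le K\left(\frac{x^q}{y^{q/2}}\exp\left(q\left(q\exp\left(-\frac{\log x\cdot\log\log\log x}{C\log\log x}\right)+2\log\log x\right)\right)+\left(\frac{x}{(\log x)^{C}}\right)^{q}\right).$$ -/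

import Mathlib

open MeasureTheory ProbabilityTheory

/-- The family `(ε p)`, for `p` prime, consists of independent random variables on the probability
space `(Ω, μ)`, each taking the values `1` and `-1` with probability `1 / 2`.
The values of `ε` at indices that are not prime play no role. -/
structure IsRademacherOnPrimes {Ω : Type*} [MeasurableSpace Ω] (μ : Measure Ω)
    (ε : ℕ → Ω → ℝ) : Prop where
  measurable : ∀ p : ℕ, p.Prime → Measurable (ε p)
  indep : iIndepFun (fun p : Nat.Primes => ε (p : ℕ)) μ
  prob_one : ∀ p : ℕ, p.Prime → μ {ω | ε p ω = 1} = 1 / 2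
  prob_neg_one : ∀ p : ℕ, p.Prime → μ {ω | ε p ω = -1} = 1 / 2

/-- The completely multiplicative function with prescribed values `a p` at the primes `p`:
`f n = ∏ a p ^ k` over the prime powers `p ^ k` exactly dividing `n`, for `n ≥ 1`. -/
def completelyMultiplicative (a : ℕ → ℝ) (n : ℕ) : ℝ :=
  n.factorization.prod fun p k => a p ^ k

/-- The partial sum `∑_{n ≤ x} f(n)` over the integers `1 ≤ n ≤ x` of the random completely
multiplicative function `f` with `f(p) = ε p` at the primes `p`. -/
noncomputable def randomPartialSum {Ω : Type*} (ε : ℕ → Ω → ℝ) (x : ℝ) (ω : Ω) : ℝ :=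
  ∑ n ∈ Finset.Icc 1 ⌊x⌋₊, completelyMultiplicative (fun p => ε p ω) n

/-! Write L = log x, ℓ = log L, m = log ℓ and a = L m / (C ℓ). If q ≥ (L/2) exp(a), the trivial
bound x^q already lies below the first term, because there exp(q · q exp(-a)) ≥ x^(q/2) ≥ y^(q/2).
So y plays no further role, and for smaller q the second term alone has to suffice. The sum is then
split at M = ⌈exp(a) L^(2C+8)⌉ into the integers all of whose primes are below M and those having a
prime factor p ≥ M.

The smooth part is bounded by its number of terms. A plain Rankin bound loses a factor log M, which
would spoil the exponent C. Weighting by log n and writing log as a divisor sum of Λ removes it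
(`card_smooth_le`). With Rankin exponent 1 - η / log M and η = m + 1, the saving is exp(-η L / log
M), about exp(-Cℓ - Cℓ/m). The Euler product costs only exp(O(ℓ/m)), so a large C leaves a genuine
surplus (`neg_mul_div_add_le`, `eventually_card_smooth_le`).

For the rest, every f(n) has nonnegative expectation, so moments of nonnegative combinations of the
f(n) increase when such a combination is added. The sum may therefore be enlarged to the product x ·
(∑ ε_p / p over p ≥ M) · (∑ f(m)/m). The last factor is at most 1 + L, and the prime sum is
sub-Gaussian with variance at most 2/M, so its q-th moment is of size (q/M)^(q/2) up to constants to
the power q (`integral_sum_not_smooth_pow_le_of_pos`). This is small enough because q/M < L^(-2C-7).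
Bounded x is absorbed in K. -/

/-! ### Partial summation and sums over primes -/

/-- Summation by parts as a comparison principle. -/
theorem sum_mul_le_sum_mul_of_sum_le {a b g : ℕ → ℝ} (hg : Antitone g) (hg0 : ∀ n, 0 ≤ g n) (N : ℕ)
    (h : ∀ n ≤ N, ∑ k ∈ Finset.range n, a k ≤ ∑ k ∈ Finset.range n, b k) :
    ∑ k ∈ Finset.range N, a k * g k ≤ ∑ k ∈ Finset.range N, b k * g k := by
  have key : ∀ n, n + 1 ≤ N → (∑ k ∈ Finset.range (n + 1), (b k - a k)) * g n ≤
      ∑ k ∈ Finset.range (n + 1), (b k - a k) * g k := by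
    intro n
    induction n with
    | zero => intro _; simp
    | succ n ih =>
      intro hn
      rw [Finset.sum_range_succ, Finset.sum_range_succ _ (n + 1), add_mul]
      have h1 := ih (by omega)
      have h2 : 0 ≤ ∑ k ∈ Finset.range (n + 1), (b k - a k) := by
        rw [Finset.sum_sub_distrib]; linarith [h (n + 1) (by omega)]
      have h3 := mul_le_mul_of_nonneg_left (hg (Nat.le_succ n)) h2
      simp only [Nat.succ_eq_add_one] at h3
      linarith
  rcases N with _ | n
  · simp
  · have h1 := key n le_rfl
    have h2 : 0 ≤ ∑ k ∈ Finset.range (n + 1), (b k - a k) := by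
      rw [Finset.sum_sub_distrib]; linarith [h (n + 1) le_rfl]
    have h3 := mul_nonneg h2 (hg0 n)
    have h4 : ∑ k ∈ Finset.range (n + 1), (b k - a k) * g k =
      ∑ k ∈ Finset.range (n + 1), b k * g k - ∑ k ∈ Finset.range (n + 1), a k * g k := by
      rw [← Finset.sum_sub_distrib]; exact Finset.sum_congr rfl fun _ _ => by ring
    linarith

open scoped ArithmeticFunction.vonMangoldt in
theorem sum_log_eq_sum_vonMangoldt (n : ℕ) :
    ∑ m ∈ Finset.Ioc 0 n, Real.log m = ∑ d ∈ Finset.Ioc 0 n, Λ d * (n / d : ℕ) := by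
  have h : ∀ m ∈ Finset.Ioc 0 n, Real.log m = ∑ d ∈ Finset.Ioc 0 n, if d ∣ m then Λ d else 0 := by
    intro m hm
    rw [Finset.mem_Ioc] at hm
    rw [← ArithmeticFunction.vonMangoldt_sum, ← Finset.sum_filter]
    refine Finset.sum_congr ?_ fun _ _ => rfl
    ext d
    simp only [Nat.mem_divisors, Finset.mem_filter, Finset.mem_Ioc]
    constructor
    · rintro ⟨h1, h2⟩
      exact ⟨⟨Nat.pos_of_dvd_of_pos h1 hm.1, (Nat.le_of_dvd hm.1 h1).trans hm.2⟩, h1⟩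
    · rintro ⟨_, h1⟩
      exact ⟨h1, hm.1.ne'⟩
  rw [Finset.sum_congr rfl h, Finset.sum_comm]
  refine Finset.sum_congr rfl fun d _ => ?_
  rw [← Finset.sum_filter, Finset.sum_const, Nat.Ioc_filter_dvd_card_eq_div, nsmul_eq_mul, mul_comm]

open scoped ArithmeticFunction.vonMangoldt in
-- Mertens' argument: in log n! = ∑ Λ(d) ⌊n/d⌋ ≤ n log n only the primes are kept. Removing the
-- floors costs θ(n) ≤ 2n.
theorem sum_primes_log_div_le {n : ℕ} (hn : 1 ≤ n) :
    ∑ p ∈ Finset.Ioc 0 n with p.Prime, Real.log p / p ≤ Real.log n + 2 := by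
  have hn' : (0 : ℝ) < n := by exact_mod_cast hn
  have h1 : ∑ m ∈ Finset.Ioc 0 n, Real.log m ≤ n * Real.log n := by
    calc _ ≤ ∑ m ∈ Finset.Ioc 0 n, Real.log n := by
          refine Finset.sum_le_sum fun m hm => ?_
          rw [Finset.mem_Ioc] at hm
          exact Real.log_le_log (by exact_mod_cast hm.1) (by exact_mod_cast hm.2)
      _ = _ := by simp
  have h2 : ∑ p ∈ Finset.Ioc 0 n with p.Prime, (n * (Real.log p / p) - Real.log p) ≤
      ∑ d ∈ Finset.Ioc 0 n, Λ d * (n / d : ℕ) := by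
    calc _ ≤ ∑ d ∈ Finset.Ioc 0 n with d.Prime, Λ d * (n / d : ℕ) := by
          refine Finset.sum_le_sum fun p hp => ?_
          rw [Finset.mem_filter, Finset.mem_Ioc] at hp
          rw [ArithmeticFunction.vonMangoldt_apply_prime hp.2]
          have hl : 0 ≤ Real.log p := Real.log_natCast_nonneg p
          have h3 : (n : ℝ) / p - 1 ≤ (n / p : ℕ) := by
            have := (Nat.lt_floor_add_one ((n : ℝ) / p)).le
            rw [Nat.floor_div_eq_div] at this
            linarith
          calc _ = Real.log p * ((n : ℝ) / p - 1) := by ring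
            _ ≤ _ := mul_le_mul_of_nonneg_left h3 hl
      _ ≤ _ := by
          refine Finset.sum_le_sum_of_subset_of_nonneg (Finset.filter_subset _ _) fun d _ _ => ?_
          exact mul_nonneg ArithmeticFunction.vonMangoldt_nonneg (Nat.cast_nonneg _)
  rw [← sum_log_eq_sum_vonMangoldt, Finset.sum_sub_distrib, ← Finset.mul_sum] at h2
  have h3 : ∑ p ∈ Finset.Ioc 0 n with p.Prime, Real.log p ≤ 2 * n := by
    have := Chebyshev.theta_le_log4_mul_x hn'.le
    rw [Chebyshev.theta, Nat.floor_natCast] at this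
    have h4 : Real.log 4 ≤ 2 := by
      rw [show (4 : ℝ) = 2 ^ 2 by norm_num, Real.log_pow]
      have := Real.log_two_lt_d9
      push_cast; linarith
    nlinarith
  have h5 : (n : ℝ) * ∑ p ∈ Finset.Ioc 0 n with p.Prime, Real.log p / p ≤ n * (Real.log n + 2) := by
    nlinarith
  exact le_of_mul_le_mul_left h5 hn'

theorem primeCounting_mul_log_le {n : ℕ} (hn : 2 ≤ n) : n.primeCounting * Real.log n ≤ 8 * n := by
  have hn' : (1 : ℝ) < n := by exact_mod_cast hn
  have h := Chebyshev.pi_le_log4_mul_div hn'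
  rw [Nat.floor_natCast] at h
  have hl : 0 < Real.log n := Real.log_pos hn'
  have hs : Real.log √n = Real.log n / 2 := Real.log_sqrt (by positivity)
  have h4 : Real.log 4 ≤ 2 := by
    rw [show (4 : ℝ) = 2 ^ 2 by norm_num, Real.log_pow]
    have := Real.log_two_lt_d9
    push_cast; linarith
  have hsq : √(n : ℝ) * √n = n := Real.mul_self_sqrt (by positivity)
  have h5 : Real.log n ≤ 2 * √n := by
    have : Real.log √n ≤ √n - 1 := Real.log_le_sub_one_of_pos (by positivity)
    linarith
  calc n.primeCounting * Real.log n ≤ (Real.log 4 * n / Real.log √n + √n) * Real.log n :=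
        mul_le_mul_of_nonneg_right h hl.le
    _ = 2 * Real.log 4 * n + √n * Real.log n := by rw [hs]; field_simp
    _ ≤ 8 * n := by nlinarith [Real.sqrt_nonneg (n : ℝ)]

theorem sum_primes_inv_le {M : ℕ} (hM : 3 ≤ M) :
    ∑ p ∈ M.primesBelow, (1 / p : ℝ) ≤ Real.log (Real.log M) + 6 := by
  set a : ℕ → ℝ := fun k => if k.Prime then Real.log k / k else 0
  -- The increments of the Mertens bound: the partial sum over k ≤ n is log n + 2 for n ≥ 2, with
  -- all the initial mass at k = 2.
  set b : ℕ → ℝ := fun k => if k < 2 then 0 else if k = 2 then Real.log 2 + 2 else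
    Real.log k - Real.log (k - 1 : ℕ)
  set g : ℕ → ℝ := fun k => (Real.log (max k 2 : ℕ))⁻¹
  have hl2 : 0 < Real.log 2 := Real.log_pos (by norm_num)
  have hpos : ∀ k : ℕ, 0 < Real.log (max k 2 : ℕ) := fun k =>
    Real.log_pos (by have : 2 ≤ max k 2 := le_max_right _ _; exact_mod_cast this)
  have hg : Antitone g := by
    intro i j hij
    refine inv_anti₀ (hpos i) (Real.log_le_log ?_ ?_)
    · have : 0 < max i 2 := by omega
      exact_mod_cast this
    · have : max i 2 ≤ max j 2 := by omega
      exact_mod_cast this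
  have hb : ∀ n, ∑ k ∈ Finset.range (n + 3), b k = Real.log (n + 2 : ℕ) + 2 := by
    intro n
    induction n with
    | zero => simp [Finset.sum_range_succ, b]
    | succ n ih =>
      rw [Finset.sum_range_succ, ih]
      simp only [b]
      rw [if_neg (by omega), if_neg (by omega)]
      simp only [show n + 3 - 1 = n + 2 by omega, show n + 1 + 2 = n + 3 by ring]
      ring
  have h := sum_mul_le_sum_mul_of_sum_le (a := a) (b := b) hg (fun k => (inv_pos.2 (hpos k)).le) M (by
    intro n _
    rcases lt_or_ge n 3 with h | h
    · have h1 : ∑ k ∈ Finset.range n, a k = 0 := by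
        refine Finset.sum_eq_zero fun k hk => ?_
        rw [Finset.mem_range] at hk
        have : ¬ k.Prime := fun hp => by have := hp.two_le; omega
        simp [a, this]
      rw [h1]
      refine Finset.sum_nonneg fun k hk => ?_
      rw [Finset.mem_range] at hk
      simp only [b]
      split_ifs
      · exact le_rfl
      · linarith
      · omega
    · obtain ⟨m, rfl⟩ := Nat.exists_eq_add_of_le' h
      rw [hb, ← Finset.sum_filter]
      refine le_trans (le_of_eq ?_) (sum_primes_log_div_le (n := m + 2) (by omega))
      refine Finset.sum_congr ?_ fun _ _ => rfl
      ext p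
      simp only [Finset.mem_filter, Finset.mem_range, Finset.mem_Ioc]
      constructor
      · rintro ⟨h1, h2⟩; exact ⟨⟨h2.pos, by omega⟩, h2⟩
      · rintro ⟨h1, h2⟩; exact ⟨by omega, h2⟩)
  have h1 : ∑ k ∈ Finset.range M, a k * g k = ∑ p ∈ M.primesBelow, (1 / p : ℝ) := by
    rw [Nat.primesBelow, Finset.sum_filter]
    refine Finset.sum_congr rfl fun k _ => ?_
    simp only [a, g]
    split_ifs with hk
    · rw [max_eq_left hk.two_le]
      have : 0 < Real.log k := Real.log_pos (by exact_mod_cast hk.one_lt)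
      field_simp
    · simp
  have h2 : ∀ n, ∑ k ∈ Finset.range (n + 3), b k * g k ≤
      Real.log (Real.log (n + 2 : ℕ)) - Real.log (Real.log 2) + (Real.log 2 + 2) / Real.log 2 := by
    intro n
    induction n with
    | zero => simp [Finset.sum_range_succ, b, g, div_eq_mul_inv]
    | succ n ih =>
      rw [Finset.sum_range_succ]
      simp only [b, g]
      rw [if_neg (by omega), if_neg (by omega), max_eq_left (by omega)]
      simp only [show n + 3 - 1 = n + 2 by omega, show n + 1 + 2 = n + 3 by ring]
      have e1 : 0 < Real.log (n + 2 : ℕ) := Real.log_pos (by push_cast; linarith [(Nat.cast_nonneg n : (0:ℝ) ≤ n)])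
      have e2 : 0 < Real.log (n + 3 : ℕ) := Real.log_pos (by push_cast; linarith [(Nat.cast_nonneg n : (0:ℝ) ≤ n)])
      -- From log t ≤ t - 1 at t = log(k-1) / log k: the increment 1 - t is at most log log k - log
      -- log(k-1), and the sum telescopes.
      have e3 := Real.log_le_sub_one_of_pos (div_pos e1 e2)
      rw [Real.log_div e1.ne' e2.ne'] at e3
      have e4 : (Real.log (n + 3 : ℕ) - Real.log (n + 2 : ℕ)) * (Real.log (n + 3 : ℕ))⁻¹ =
        1 - Real.log (n + 2 : ℕ) / Real.log (n + 3 : ℕ) := by field_simp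
      rw [e4]
      linarith
  obtain ⟨m, rfl⟩ := Nat.exists_eq_add_of_le' hM
  have h3 := h2 m
  have e5 : Real.log (Real.log (m + 2 : ℕ)) ≤ Real.log (Real.log (m + 3 : ℕ)) := by
    have e1 : 0 < Real.log (m + 2 : ℕ) := Real.log_pos (by push_cast; linarith [(Nat.cast_nonneg m : (0:ℝ) ≤ m)])
    refine Real.log_le_log e1 (Real.log_le_log (by positivity) (by push_cast; linarith))
  have e6 : (Real.log 2 + 2) / Real.log 2 ≤ 5 := by
    rw [div_le_iff₀ hl2]; linarith [Real.log_two_gt_d9]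
  have e7 : -1 ≤ Real.log (Real.log 2) := by
    have := Real.one_sub_inv_le_log_of_pos hl2
    have : (Real.log 2)⁻¹ ≤ 2 := by
      rw [inv_le_comm₀ hl2 (by norm_num)]; linarith [Real.log_two_gt_d9]
    linarith
  linarith

/-- Bernoulli's inequality gives s k^(s-1) ≤ k^s - (k-1)^s, which telescopes. -/
theorem sum_natCast_rpow_neg_le {s : ℝ} (hs0 : 0 < s) (hs1 : s < 1) (N : ℕ) :
    ∑ k ∈ Finset.Ico 1 N, (k : ℝ) ^ (-(1 - s)) ≤ (N : ℝ) ^ s / s := by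
  have h : ∀ n : ℕ, ∑ k ∈ Finset.range n, ((k + 1 : ℕ) : ℝ) ^ (-(1 - s)) ≤ (n : ℝ) ^ s / s := by
    intro n
    induction n with
    | zero => simp [Real.zero_rpow hs0.ne']
    | succ n ih =>
      rw [Finset.sum_range_succ]
      have hp : (0 : ℝ) < (n + 1 : ℕ) := by positivity
      have hb : (1 + (-1 / (n + 1 : ℕ) : ℝ)) ^ s ≤ 1 + s * (-1 / (n + 1 : ℕ)) := by
        refine rpow_one_add_le_one_add_mul_self ?_ hs0.le hs1.le
        rw [le_div_iff₀ hp]; push_cast; linarith [(Nat.cast_nonneg n : (0:ℝ) ≤ n)]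
      have e1 : 1 + (-1 / (n + 1 : ℕ) : ℝ) = n / (n + 1 : ℕ) := by push_cast; field_simp; ring
      rw [e1, Real.div_rpow (Nat.cast_nonneg n) hp.le, div_le_iff₀ (by positivity)] at hb
      have e2 : ((n + 1 : ℕ) : ℝ) ^ (-(1 - s)) = ((n + 1 : ℕ) : ℝ) ^ s / (n + 1 : ℕ) := by
        rw [show -(1 - s) = s - 1 by ring, Real.rpow_sub hp, Real.rpow_one]
      rw [e2]
      rw [le_div_iff₀ hs0] at ih ⊢
      have : (1 + s * (-1 / (n + 1 : ℕ) : ℝ)) * ((n + 1 : ℕ) : ℝ) ^ s = ((n + 1 : ℕ) : ℝ) ^ s -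
        ((n + 1 : ℕ) : ℝ) ^ s / (n + 1 : ℕ) * s := by ring
      linarith
  rcases N with _ | n
  · simp [Real.zero_rpow hs0.ne']
  · rw [Finset.sum_Ico_eq_sum_range]
    simp only [Nat.add_sub_cancel, add_comm 1]
    refine (h n).trans ?_
    gcongr
    simp

/-- Beyond √M the primes have density at most 16 / log M in the sense of partial sums: as soon as
one is counted, log n ≥ (log M)/2 and Chebyshev applies. Below √M the left side vanishes. -/
theorem card_primes_sqrt_lt_le {M : ℕ} (hM : 3 ≤ M) (n : ℕ) :
    (((Finset.range n).filter fun p => p.Prime ∧ M < p ^ 2).card : ℝ) ≤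
      ∑ k ∈ Finset.range n, if 1 ≤ k then 16 / Real.log M else 0 := by
  have hl : 0 < Real.log M := Real.log_pos (by exact_mod_cast (by omega : 1 < M))
  rcases n with _ | n
  · simp
  have h1 : ∑ k ∈ Finset.range (n + 1), (if 1 ≤ k then 16 / Real.log M else 0) =
      n * (16 / Real.log M) := by
    rw [Finset.sum_range_succ']; simp
  rw [h1]
  by_cases h : ∃ p ∈ Finset.range (n + 1), p.Prime ∧ M < p ^ 2
  · obtain ⟨p, hp, hp1, hp2⟩ := h
    rw [Finset.mem_range] at hp
    have hn : 2 ≤ n := hp1.two_le.trans (by omega)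
    have h2 : (((Finset.range (n + 1)).filter fun p => p.Prime ∧ M < p ^ 2).card : ℝ) ≤
        n.primeCounting := by
      rw [Nat.primeCounting, Nat.primeCounting', Nat.count_eq_card_filter_range]
      norm_cast
      exact Finset.card_le_card fun q hq => by
        simp only [Finset.mem_filter] at hq ⊢; exact ⟨hq.1, hq.2.1⟩
    have h3 := primeCounting_mul_log_le hn
    have h4 : Real.log M ≤ 2 * Real.log n := by
      have : (M : ℝ) ≤ (n : ℝ) ^ 2 := by
        exact_mod_cast hp2.le.trans (Nat.pow_le_pow_left (by omega) 2)
      calc Real.log M ≤ Real.log ((n : ℝ) ^ 2) :=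
            Real.log_le_log (by exact_mod_cast (by omega : 0 < M)) this
        _ = _ := by rw [Real.log_pow]; push_cast; ring
    refine h2.trans ?_
    rw [mul_div_assoc', le_div_iff₀ hl]
    nlinarith [(Nat.cast_nonneg n.primeCounting : (0:ℝ) ≤ n.primeCounting)]
  · push Not at h
    rw [Finset.filter_false_of_mem fun p hp hh => by have := h p hp hh.1; omega]
    simp; positivity

theorem sum_primes_sqrt_lt_rpow_neg_le {M : ℕ} (hM : 3 ≤ M) {s : ℝ} (hs0 : 0 < s) (hs1 : s < 1) :
    ∑ p ∈ M.primesBelow with M < p ^ 2, (p : ℝ) ^ (-(1 - s)) ≤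
      16 / Real.log M * ((M : ℝ) ^ s / s) := by
  have hl : 0 < Real.log M := Real.log_pos (by exact_mod_cast (by omega : 1 < M))
  set g : ℕ → ℝ := fun k => ((max k 1 : ℕ) : ℝ) ^ (-(1 - s))
  have hg : Antitone g := by
    intro i j hij
    refine Real.rpow_le_rpow_of_nonpos ?_ ?_ (by linarith)
    · have : 0 < max i 1 := by omega
      exact_mod_cast this
    · have : max i 1 ≤ max j 1 := by omega
      exact_mod_cast this
  have h := sum_mul_le_sum_mul_of_sum_le (a := fun k => if k.Prime ∧ M < k ^ 2 then 1 else 0)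
    (b := fun k => if 1 ≤ k then 16 / Real.log M else 0) hg (fun k => by positivity) M (by
      intro n _
      rw [← Finset.sum_filter, Finset.sum_const, nsmul_eq_mul, mul_one]
      exact card_primes_sqrt_lt_le hM n)
  calc _ = ∑ k ∈ Finset.range M, (if k.Prime ∧ M < k ^ 2 then 1 else 0) * g k := by
        rw [Nat.primesBelow, Finset.filter_filter, Finset.sum_filter]
        refine Finset.sum_congr rfl fun k _ => ?_
        split_ifs with hk
        · simp only [g]; rw [max_eq_left hk.1.one_lt.le, one_mul]
        · simp
    _ ≤ _ := h
    _ = 16 / Real.log M * ∑ k ∈ Finset.Ico 1 M, (k : ℝ) ^ (-(1 - s)) := by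
        rw [Finset.mul_sum, ← Finset.sum_filter_add_sum_filter_not _ (fun k => 1 ≤ k)]
        rw [Finset.sum_eq_zero (s := Finset.filter (fun k => ¬ 1 ≤ k) _), add_zero]
        · refine Finset.sum_congr ?_ fun k hk => ?_
          · ext k; simp [and_comm]
          · rw [Finset.mem_Ico] at hk
            simp only [g]
            rw [if_pos hk.1, max_eq_left hk.1]
        · intro k hk
          rw [Finset.mem_filter] at hk
          rw [if_neg hk.2, zero_mul]
    _ ≤ _ := by
        gcongr
        exact sum_natCast_rpow_neg_le hs0 hs1 M

/-- The sum is split at √M. Above it, the density bound gives a multiple of exp(η)/η without a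
further log log M. Below it, p^(η / log M) differs from 1 by at most (η log p / log M) exp(η/2), and
both Mertens sums apply. -/
theorem sum_primes_rpow_neg_le {M : ℕ} (hM : 3 ≤ M) {η : ℝ} (hη : 1 ≤ η) (hη' : η < Real.log M) :
    ∑ p ∈ M.primesBelow, (p : ℝ) ^ (-(1 - η / Real.log M)) ≤
      Real.log (Real.log M) + 70 * (Real.exp η / η) := by
  have hM0 : (0 : ℝ) < M := by exact_mod_cast (by omega : 0 < M)
  have hl : 0 < Real.log M := by linarith
  have hη0 : 0 < η := by linarith
  set l := Real.log M with hldef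
  have h1 : ∑ p ∈ M.primesBelow with M < p ^ 2, (p : ℝ) ^ (-(1 - η / l)) ≤
      16 * (Real.exp η / η) := by
    refine (sum_primes_sqrt_lt_rpow_neg_le hM (div_pos hη0 hl) ((div_lt_one hl).2 hη')).trans
      (le_of_eq ?_)
    rw [← hldef, Real.rpow_def_of_pos hM0, ← hldef, mul_div_cancel₀ _ hl.ne']
    field_simp
  have h2 : ∑ p ∈ M.primesBelow with ¬ M < p ^ 2, (p : ℝ) ^ (-(1 - η / l)) ≤
      ∑ p ∈ M.primesBelow, (1 / p : ℝ) +
        η * Real.exp (η / 2) / l * ∑ p ∈ M.primesBelow, Real.log p / p := by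
    calc _ ≤ ∑ p ∈ M.primesBelow with ¬ M < p ^ 2, ((1 / p : ℝ) +
          η * Real.exp (η / 2) / l * (Real.log p / p)) := by
          refine Finset.sum_le_sum fun p hp => ?_
          rw [Finset.mem_filter, Nat.mem_primesBelow] at hp
          obtain ⟨⟨_, hp1⟩, hp2⟩ := hp
          have hp0 : (0 : ℝ) < p := by exact_mod_cast hp1.pos
          have hpl : 0 < Real.log p := Real.log_pos (by exact_mod_cast hp1.one_lt)
          have h3 : 2 * Real.log p ≤ l := by
            have : ((p ^ 2 : ℕ) : ℝ) ≤ M := by exact_mod_cast not_lt.1 hp2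
            have := Real.log_le_log (by exact_mod_cast pow_pos hp1.pos 2) this
            rw [Nat.cast_pow, Real.log_pow] at this
            exact_mod_cast this
          set t := η / l * Real.log p
          have ht : 0 ≤ t := by positivity
          have ht2 : t ≤ η / 2 := by
            have : η / l * (2 * Real.log p) ≤ η / l * l :=
              mul_le_mul_of_nonneg_left h3 (by positivity)
            rw [div_mul_cancel₀ _ hl.ne'] at this
            simp only [t]; linarith
          have h4 : (p : ℝ) ^ (-(1 - η / l)) = 1 / p * Real.exp t := by
            rw [show -(1 - η / l) = η / l - 1 by ring, Real.rpow_sub hp0, Real.rpow_one,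
              Real.rpow_def_of_pos hp0, mul_comm (Real.log p)]
            ring
          -- Multiplying 1 - t ≤ exp(-t) by exp(t) gives exp(t) ≤ 1 + t exp(t).
          have h5 : Real.exp t ≤ 1 + t * Real.exp (η / 2) := by
            have h6 := Real.add_one_le_exp (-t)
            have h7 : Real.exp t * Real.exp (-t) = 1 := by rw [← Real.exp_add]; simp
            have h8 := Real.exp_le_exp.2 ht2
            nlinarith [Real.exp_pos t]
          rw [h4]
          calc 1 / (p : ℝ) * Real.exp t ≤ 1 / p * (1 + t * Real.exp (η / 2)) := by gcongr
            _ = _ := by simp only [t]; ring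
      _ ≤ ∑ p ∈ M.primesBelow, ((1 / p : ℝ) + η * Real.exp (η / 2) / l * (Real.log p / p)) := by
          refine Finset.sum_le_sum_of_subset_of_nonneg (Finset.filter_subset _ _) fun p _ _ => ?_
          have := Real.log_natCast_nonneg p
          positivity
      _ = _ := by rw [Finset.sum_add_distrib, Finset.mul_sum]
  have h3 : ∑ p ∈ M.primesBelow, Real.log p / p ≤ 3 * l := by
    refine le_trans ?_ ((sum_primes_log_div_le (n := M) (by omega)).trans (by linarith))
    refine Finset.sum_le_sum_of_subset_of_nonneg ?_ fun p _ _ =>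
      div_nonneg (Real.log_natCast_nonneg p) (Nat.cast_nonneg p)
    intro p hp
    rw [Nat.mem_primesBelow] at hp
    rw [Finset.mem_filter, Finset.mem_Ioc]
    exact ⟨⟨hp.2.pos, hp.1.le⟩, hp.2⟩
  have h4 := sum_primes_inv_le hM
  have h5 : η * Real.exp (η / 2) / l * ∑ p ∈ M.primesBelow, Real.log p / p ≤
      3 * (η * Real.exp (η / 2)) := by
    calc _ ≤ η * Real.exp (η / 2) / l * (3 * l) := by gcongr
      _ = _ := by field_simp
  have h6 : η * Real.exp (η / 2) ≤ 8 * (Real.exp η / η) := by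
    have h7 : Real.exp η = Real.exp (η / 2) * Real.exp (η / 2) := by rw [← Real.exp_add]; ring_nf
    have h8 := Real.quadratic_le_exp_of_nonneg (x := η / 2) (by positivity)
    rw [mul_div_assoc', le_div_iff₀ hη0, h7]
    nlinarith [Real.exp_pos (η / 2)]
  have h9 : 1 ≤ Real.exp η / η := by
    rw [le_div_iff₀ hη0]; linarith [Real.add_one_le_exp η]
  rw [← Finset.sum_filter_add_sum_filter_not _ (fun p => M < p ^ 2)]
  rw [← hldef] at h4
  linarith

/-! ### Euler products and the count of smooth numbers -/

/-- Each t = p^(-σ) is at most 2/3, so 1/(1-t) ≤ exp(t + 3t²), and the squares are dominated by the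
convergent series of n^(-3/2), uniformly in M and σ. -/
theorem prod_primes_inv_one_sub_rpow_le :
    ∃ c : ℝ, 0 < c ∧ ∀ (M : ℕ) (σ : ℝ), 3 / 4 ≤ σ →
      ∏ p ∈ M.primesBelow, (1 - (p : ℝ) ^ (-σ))⁻¹ ≤
        Real.exp (∑ p ∈ M.primesBelow, (p : ℝ) ^ (-σ) + c) := by
  have hsum : Summable fun n : ℕ => (n : ℝ) ^ (-(3 / 2) : ℝ) :=
    Real.summable_nat_rpow.2 (by norm_num)
  refine ⟨3 * ∑' n : ℕ, (n : ℝ) ^ (-(3 / 2) : ℝ) + 1, ?_, fun M σ hσ => ?_⟩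
  · have : 0 ≤ ∑' n : ℕ, (n : ℝ) ^ (-(3 / 2) : ℝ) := tsum_nonneg fun n => by positivity
    linarith
  have h1 : ∏ p ∈ M.primesBelow, (1 - (p : ℝ) ^ (-σ))⁻¹ ≤
      ∏ p ∈ M.primesBelow, Real.exp ((p : ℝ) ^ (-σ) + 3 * (p : ℝ) ^ (-(3 / 2) : ℝ)) := by
    have hb : ∀ p ∈ M.primesBelow, (p : ℝ) ^ (-σ) ≤ 2 / 3 := by
      intro p hp
      rw [Nat.mem_primesBelow] at hp
      have hp2 : (2 : ℝ) ≤ p := by exact_mod_cast hp.2.two_le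
      calc (p : ℝ) ^ (-σ) ≤ (p : ℝ) ^ (-(3 / 4) : ℝ) :=
            Real.rpow_le_rpow_of_exponent_le (by linarith) (by linarith)
        _ ≤ (2 : ℝ) ^ (-(3 / 4) : ℝ) :=
            Real.rpow_le_rpow_of_nonpos (by norm_num) hp2 (by norm_num)
        _ ≤ 2 / 3 := by
            rw [Real.rpow_neg (by norm_num), inv_le_comm₀ (by positivity) (by norm_num)]
            refine le_of_pow_le_pow_left₀ (n := 4) (by norm_num) (by positivity) ?_
            rw [← Real.rpow_natCast ((2 : ℝ) ^ (3 / 4 : ℝ)), ← Real.rpow_mul (by norm_num)]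
            norm_num
    refine Finset.prod_le_prod (fun p hp => ?_) fun p hp => ?_
    · have := hb p hp
      exact inv_nonneg.2 (by linarith)
    · have h2 := hb p hp
      rw [Nat.mem_primesBelow] at hp
      have hp1 : (1 : ℝ) ≤ p := by exact_mod_cast hp.2.one_lt.le
      set t := (p : ℝ) ^ (-σ) with ht
      have ht0 : 0 ≤ t := by positivity
      have h3 : t ^ 2 ≤ (p : ℝ) ^ (-(3 / 2) : ℝ) := by
        rw [ht, ← Real.rpow_natCast, ← Real.rpow_mul (by positivity)]
        exact Real.rpow_le_rpow_of_exponent_le hp1 (by push_cast; linarith)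
      have h4 : 0 < 1 - t := by linarith
      have h5 : (1 - t)⁻¹ ≤ Real.exp (t + 3 * t ^ 2) := by
        have h6 := Real.add_one_le_exp ((1 - t)⁻¹ - 1)
        have h7 : (1 - t)⁻¹ - 1 ≤ t + 3 * t ^ 2 := by
          have : (1 - t)⁻¹ - 1 = t / (1 - t) := by field_simp; ring
          rw [this, div_le_iff₀ h4]
          nlinarith [mul_nonneg (sq_nonneg t) (by linarith : 0 ≤ 2 / 3 - t)]
        calc (1 - t)⁻¹ ≤ Real.exp ((1 - t)⁻¹ - 1) := by linarith
          _ ≤ _ := Real.exp_le_exp.2 h7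
      exact h5.trans (Real.exp_le_exp.2 (by linarith))
  refine h1.trans ?_
  rw [← Real.exp_sum, Finset.sum_add_distrib, ← Finset.mul_sum]
  have := hsum.sum_le_tsum M.primesBelow fun n _ => by positivity
  exact Real.exp_le_exp.2 (by linarith)

theorem sum_smooth_rpow_neg_le_prod (M : ℕ) {σ : ℝ} (hσ : 0 < σ) (s : Finset ℕ)
    (hs : ∀ m ∈ s, m ∈ M.smoothNumbers) :
    ∑ m ∈ s, (m : ℝ) ^ (-σ) ≤ ∏ p ∈ M.primesBelow, (1 - (p : ℝ) ^ (-σ))⁻¹ := by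
  let f : ℕ →* ℝ :=
    { toFun := fun n => (n : ℝ) ^ (-σ)
      map_one' := by simp
      map_mul' := fun a b => by
        simp only [Nat.cast_mul]
        exact Real.mul_rpow (Nat.cast_nonneg a) (Nat.cast_nonneg b) }
  have h := (EulerProduct.summable_and_hasSum_smoothNumbers_prod_primesBelow_geometric (f := f)
    (fun {p} hp => by
      change ‖(p : ℝ) ^ (-σ)‖ < 1
      rw [Real.norm_of_nonneg (by positivity)]
      exact Real.rpow_lt_one_of_one_lt_of_neg (by exact_mod_cast hp.one_lt) (by linarith)) M).2
  have h2 := h.summable.sum_le_tsum (s.attach.map ⟨fun m : s => (⟨m.1, hs m.1 m.2⟩ : M.smoothNumbers),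
    fun a b hab => Subtype.ext (congrArg (fun m : M.smoothNumbers => (m : ℕ)) hab)⟩) fun m _ => by
      change 0 ≤ ((m : ℕ) : ℝ) ^ (-σ); positivity
  rw [h.tsum_eq, Finset.sum_map] at h2
  rw [← Finset.sum_attach]
  exact h2

open scoped ArithmeticFunction.vonMangoldt in
theorem sum_vonMangoldt_smooth_le_psi (M : ℕ) (n : ℕ) :
    ∑ d ∈ Finset.Ioc 0 n with d ∈ M.smoothNumbers, Λ d ≤ 6 * n := by
  have h := Chebyshev.psi_le_const_mul_self (Nat.cast_nonneg (α := ℝ) n)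
  rw [Chebyshev.psi, Nat.floor_natCast] at h
  have h4 : Real.log 4 ≤ 2 := by
    rw [show (4 : ℝ) = 2 ^ 2 by norm_num, Real.log_pow]
    have := Real.log_two_lt_d9
    push_cast; linarith
  refine (Finset.sum_le_sum_of_subset_of_nonneg (Finset.filter_subset _ _) fun d _ _ =>
    ArithmeticFunction.vonMangoldt_nonneg).trans (h.trans ?_)
  have : (0 : ℝ) ≤ n := Nat.cast_nonneg n
  nlinarith

open scoped ArithmeticFunction.vonMangoldt in
theorem sum_vonMangoldt_smooth_le_card (M : ℕ) (n : ℕ) :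
    ∑ d ∈ Finset.Ioc 0 n with d ∈ M.smoothNumbers, Λ d ≤ M.primesBelow.card * Real.log n := by
  rcases Nat.eq_zero_or_pos n with rfl | hn
  · simp
  -- Every smooth prime power up to n divides D, and the sum of Λ over the divisors of D is log D.
  set D : ℕ := ∏ p ∈ M.primesBelow, p ^ (Nat.log p n)
  have hD : D ≠ 0 := Finset.prod_ne_zero_iff.2 fun p hp =>
    pow_ne_zero _ (Nat.mem_primesBelow.1 hp).2.ne_zero
  have h1 : ∑ d ∈ Finset.Ioc 0 n with d ∈ M.smoothNumbers, Λ d ≤ ∑ d ∈ D.divisors, Λ d := by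
    rw [← Finset.sum_filter_ne_zero]
    refine Finset.sum_le_sum_of_subset_of_nonneg ?_ fun d _ _ =>
      ArithmeticFunction.vonMangoldt_nonneg
    intro d hd
    rw [Finset.mem_filter, Finset.mem_filter, Finset.mem_Ioc] at hd
    obtain ⟨⟨⟨_, hdn⟩, hds⟩, hd1⟩ := hd
    rw [ne_eq, ArithmeticFunction.vonMangoldt_eq_zero_iff, not_not, isPrimePow_nat_iff] at hd1
    obtain ⟨p, k, hp, hk, rfl⟩ := hd1
    rw [Nat.mem_divisors]
    refine ⟨?_, hD⟩
    have hpM : p ∈ M.primesBelow := by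
      rw [Nat.mem_primesBelow]
      exact ⟨Nat.mem_smoothNumbers'.1 hds p hp (dvd_pow_self p hk.ne'), hp⟩
    exact (pow_dvd_pow p (Nat.le_log_of_pow_le hp.one_lt hdn)).trans
      (Finset.dvd_prod_of_mem (fun p => p ^ (Nat.log p n)) hpM)
  refine h1.trans ?_
  rw [ArithmeticFunction.vonMangoldt_sum, Nat.cast_prod, Real.log_prod, ← nsmul_eq_mul]
  · refine Finset.sum_le_card_nsmul _ _ _ fun p hp => ?_
    have hp := (Nat.mem_primesBelow.1 hp).2
    refine Real.log_le_log (by exact_mod_cast pow_pos hp.pos _) ?_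
    exact_mod_cast Nat.pow_log_le_self p hn.ne'
  · intro p hp
    exact_mod_cast pow_ne_zero _ (Nat.mem_primesBelow.1 hp).2.ne_zero

open scoped ArithmeticFunction.vonMangoldt in
-- For w ≤ M Chebyshev's bound gives O(w); for w > M only the primes below M contribute, giving O(M
-- log X / log M). Both w and M are below M^s w^(1-s) in their range. The factor 1 / log M later
-- cancels the Euler product.
theorem sum_vonMangoldt_smooth_le {M : ℕ} (hM : 3 ≤ M) {X s : ℝ} (hX : M ≤ X)
    (hs0 : 0 ≤ s) (hs1 : s ≤ 1) {n : ℕ} (hn : 1 ≤ n) {w : ℝ} (hnw : n ≤ w) (hwX : w ≤ X) :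
    ∑ d ∈ Finset.Ioc 0 n with d ∈ M.smoothNumbers, Λ d ≤
      8 * (Real.log X / Real.log M) * (M : ℝ) ^ s * w ^ (1 - s) := by
  have hM0 : (0 : ℝ) < M := by exact_mod_cast (by omega : 0 < M)
  have hl : 0 < Real.log M := Real.log_pos (by exact_mod_cast (by omega : 1 < M))
  have hn1 : (1 : ℝ) ≤ n := by exact_mod_cast hn
  have hw0 : 0 < w := by linarith
  have hlX : Real.log M ≤ Real.log X := Real.log_le_log hM0 hX
  rcases le_or_gt w M with h | h
  · refine (sum_vonMangoldt_smooth_le_psi M n).trans ?_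
    have h1 : 1 ≤ Real.log X / Real.log M := (one_le_div hl).2 hlX
    have h2 : w ≤ (M : ℝ) ^ s * w ^ (1 - s) := by
      calc w = w ^ s * w ^ (1 - s) := by rw [← Real.rpow_add hw0]; simp
        _ ≤ _ := by gcongr
    have h3 : (M : ℝ) ^ s * w ^ (1 - s) ≤
        (Real.log X / Real.log M) * ((M : ℝ) ^ s * w ^ (1 - s)) :=
      le_mul_of_one_le_left (by positivity) h1
    nlinarith
  · refine (sum_vonMangoldt_smooth_le_card M n).trans ?_
    have h1 : (M.primesBelow.card : ℝ) * Real.log M ≤ 8 * M := by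
      refine le_trans ?_ (primeCounting_mul_log_le (n := M) (by omega))
      gcongr
      rw [Nat.primesBelow_card_eq_primeCounting']
      exact Nat.count_monotone _ (Nat.le_succ M)
    have h2 : (M : ℝ) ≤ (M : ℝ) ^ s * w ^ (1 - s) := by
      calc (M : ℝ) = (M : ℝ) ^ s * (M : ℝ) ^ (1 - s) := by rw [← Real.rpow_add hM0]; simp
        _ ≤ _ := by gcongr
    have h3 : Real.log n ≤ Real.log X := Real.log_le_log (by linarith) (by linarith)
    have h5 : 0 ≤ Real.log X := hl.le.trans hlX
    calc (M.primesBelow.card : ℝ) * Real.log n ≤ (8 * M / Real.log M) * Real.log X := by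
          gcongr
          rwa [le_div_iff₀ hl]
      _ = 8 * (Real.log X / Real.log M) * M := by ring
      _ ≤ 8 * (Real.log X / Real.log M) * ((M : ℝ) ^ s * w ^ (1 - s)) := by gcongr
      _ = _ := by ring

open scoped ArithmeticFunction.vonMangoldt in
-- Expand log as a divisor sum of Λ and regroup by the cofactor; divisors of smooth numbers are
-- smooth.
theorem sum_log_smooth_le (M n : ℕ) :
    ∑ m ∈ Finset.Ioc 0 n with m ∈ M.smoothNumbers, Real.log m ≤
      ∑ m ∈ Finset.Ioc 0 n with m ∈ M.smoothNumbers,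
        ∑ d ∈ Finset.Ioc 0 (n / m) with d ∈ M.smoothNumbers, Λ d := by
  calc _ = ∑ m ∈ Finset.Ioc 0 n with m ∈ M.smoothNumbers,
        ∑ e ∈ m.divisorsAntidiagonal, Λ e.2 := by
        refine Finset.sum_congr rfl fun m _ => ?_
        rw [← ArithmeticFunction.vonMangoldt_sum, Nat.sum_divisorsAntidiagonal' (f := fun _ b => Λ b)]
    _ = ∑ q ∈ ((Finset.Ioc 0 n).filter (· ∈ M.smoothNumbers)).sigma
          (fun m => m.divisorsAntidiagonal), Λ q.2.2 := by rw [Finset.sum_sigma]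
    _ ≤ ∑ q ∈ ((Finset.Ioc 0 n).filter (· ∈ M.smoothNumbers)).sigma
          (fun m => (Finset.Ioc 0 (n / m)).filter (· ∈ M.smoothNumbers)), Λ q.2 := by
        refine le_of_eq_of_le (Finset.sum_image (s := ((Finset.Ioc 0 n).filter
          (· ∈ M.smoothNumbers)).sigma (fun m => m.divisorsAntidiagonal))
          (f := fun q : (_ : ℕ) × ℕ => Λ q.2)
          (g := fun q => (⟨q.2.1, q.2.2⟩ : (_ : ℕ) × ℕ)) ?_).symm
          (Finset.sum_le_sum_of_subset_of_nonneg ?_ fun _ _ _ =>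
            ArithmeticFunction.vonMangoldt_nonneg)
        · rintro ⟨a, b, c⟩ h ⟨a', b', c'⟩ h' heq
          simp only [Finset.coe_sigma, Set.mem_sigma_iff, Finset.mem_coe,
            Nat.mem_divisorsAntidiagonal] at h h'
          simp only [Sigma.mk.injEq, heq_eq_eq] at heq
          obtain ⟨rfl, rfl⟩ := heq
          obtain rfl : a = a' := h.2.1.symm.trans h'.2.1
          rfl
        · rintro ⟨b, c⟩ h
          simp only [Finset.mem_image, Finset.mem_sigma, Finset.mem_filter, Finset.mem_Ioc,
            Nat.mem_divisorsAntidiagonal, Sigma.exists, Prod.exists, Sigma.mk.injEq,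
            heq_eq_eq] at h ⊢
          obtain ⟨a, b', c', ⟨⟨⟨h1, h2⟩, h3⟩, h4, h5⟩, rfl, rfl⟩ := h
          subst h4
          have hb : 0 < b' := Nat.pos_of_mul_pos_right h1
          have hc : 0 < c' := Nat.pos_of_mul_pos_left h1
          exact ⟨⟨⟨hb, (Nat.le_mul_of_pos_right _ hc).trans h2⟩,
            Nat.mem_smoothNumbers_of_dvd h3 (dvd_mul_right _ _)⟩,
            ⟨hc, (Nat.le_div_iff_mul_le hb).2 (by rwa [mul_comm])⟩,
            Nat.mem_smoothNumbers_of_dvd h3 (dvd_mul_left _ _)⟩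
    _ = _ := by rw [Finset.sum_sigma]

/-- An upper bound of Rankin type for the number of smooth numbers, without the loss of a factor
`log M`. -/
theorem card_smooth_le :
    ∃ c : ℝ, 1 ≤ c ∧ ∀ (M : ℕ) (x η : ℝ), 3 ≤ M → M ≤ x → 1 ≤ η → 4 * η ≤ Real.log M →
      (((Finset.Icc 1 ⌊x⌋₊).filter (· ∈ M.smoothNumbers)).card : ℝ) ≤
        √x + c * x * Real.exp η *
          Real.exp (-(η * (Real.log x / Real.log M)) + c * (Real.exp η / η)) := by
  obtain ⟨c₀, hc₀, hprod⟩ := prod_primes_inv_one_sub_rpow_le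
  refine ⟨max 16 (70 + c₀), le_trans (by norm_num) (le_max_left _ _), ?_⟩
  intro M x η hM hMx hη hηM
  set c := max 16 (70 + c₀)
  have hM0 : (0 : ℝ) < M := by exact_mod_cast (by omega : 0 < M)
  have hx1 : (1 : ℝ) < x := lt_of_lt_of_le (by exact_mod_cast (by omega : 1 < M)) hMx
  have hx0 : 0 < x := by linarith
  have hl : 0 < Real.log M := by linarith
  have hL : 0 < Real.log x := Real.log_pos hx1
  set s := η / Real.log M with hs
  have hs0 : 0 < s := by positivity
  have hs1 : s ≤ 1 / 4 := by rw [hs, div_le_iff₀ hl]; linarith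
  set N := ⌊x⌋₊
  have hNx : (N : ℝ) ≤ x := Nat.floor_le hx0.le
  set S := (Finset.Ioc 0 N).filter (· ∈ M.smoothNumbers)
  have hSM : ∀ m ∈ S, m ∈ M.smoothNumbers := fun m hm => (Finset.mem_filter.1 hm).2
  have hIcc : (Finset.Icc 1 N).filter (· ∈ M.smoothNumbers) = S := rfl
  rw [hIcc]
  set E := Real.exp (-(η * (Real.log x / Real.log M)) + c * (Real.exp η / η))
  have hMs : (M : ℝ) ^ s = Real.exp η := by
    rw [Real.rpow_def_of_pos hM0, hs, mul_div_cancel₀ _ hl.ne']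
  have hxs : x ^ (1 - s) = x * Real.exp (-(η * (Real.log x / Real.log M))) := by
    rw [Real.rpow_sub hx0, Real.rpow_one, Real.rpow_def_of_pos hx0, Real.exp_neg, hs, div_eq_mul_inv]
    congr 3
    ring
  have h1 : ∑ m ∈ S, (m : ℝ) ^ (-(1 - s)) ≤ Real.log M * Real.exp (c * (Real.exp η / η)) := by
    refine (sum_smooth_rpow_neg_le_prod M (by linarith) S hSM).trans
      ((hprod M (1 - s) (by linarith)).trans ?_)
    have h2 := sum_primes_rpow_neg_le hM hη (by linarith)
    rw [← hs] at h2
    have h3 : 1 ≤ Real.exp η / η := by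
      rw [le_div_iff₀ (by linarith)]; linarith [Real.add_one_le_exp η]
    have h4 : (70 + c₀) * (Real.exp η / η) ≤ c * (Real.exp η / η) := by
      gcongr; exact le_max_right _ _
    calc _ ≤ Real.exp (Real.log (Real.log M) + c * (Real.exp η / η)) :=
          Real.exp_le_exp.2 (by nlinarith)
      _ = _ := by rw [Real.exp_add, Real.exp_log hl]
  -- The log M of the Euler product meets the 1 / log M of the Chebyshev-type bound, so only log x
  -- remains.
  have h2 : ∑ m ∈ S, Real.log m ≤ Real.log x * (8 * x * Real.exp η * E) := by
    calc _ ≤ ∑ m ∈ S, 8 * (Real.log x / Real.log M) * (M : ℝ) ^ s * (x / m) ^ (1 - s) := by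
          refine (sum_log_smooth_le M N).trans (Finset.sum_le_sum fun m hm => ?_)
          have hm' := Finset.mem_Ioc.1 (Finset.mem_filter.1 hm).1
          have hm0 : (1 : ℝ) ≤ m := by exact_mod_cast hm'.1
          refine sum_vonMangoldt_smooth_le hM hMx hs0.le (by linarith)
            ((Nat.one_le_div_iff hm'.1).2 hm'.2) (Nat.cast_div_le.trans ?_) ?_
          · gcongr
          · exact div_le_self hx0.le hm0
      _ = 8 * (Real.log x / Real.log M) * (M : ℝ) ^ s * x ^ (1 - s) *
          ∑ m ∈ S, (m : ℝ) ^ (-(1 - s)) := by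
          rw [Finset.mul_sum]
          refine Finset.sum_congr rfl fun m _ => ?_
          rw [Real.div_rpow hx0.le (Nat.cast_nonneg m), Real.rpow_neg (Nat.cast_nonneg m)]
          ring
      _ ≤ 8 * (Real.log x / Real.log M) * (M : ℝ) ^ s * x ^ (1 - s) *
          (Real.log M * Real.exp (c * (Real.exp η / η))) := by gcongr
      _ = _ := by
          rw [hMs, hxs]
          simp only [E]
          rw [Real.exp_add]
          field_simp
  -- Integers up to √x are counted trivially; for the others log m ≥ (log x)/2, which removes the
  -- logarithmic weight.
  have h3 : (S.card : ℝ) ≤ √x + 2 / Real.log x * ∑ m ∈ S, Real.log m := by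
    have h4 : ((S.filter fun m : ℕ => (m : ℝ) ≤ √x).card : ℝ) ≤ √x := by
      have : (S.filter fun m : ℕ => (m : ℝ) ≤ √x) ⊆ Finset.Ioc 0 ⌊√x⌋₊ := by
        intro m hm
        rw [Finset.mem_filter] at hm
        rw [Finset.mem_Ioc]
        exact ⟨(Finset.mem_Ioc.1 (Finset.mem_filter.1 hm.1).1).1, Nat.le_floor hm.2⟩
      have := Finset.card_le_card this
      rw [Nat.card_Ioc, Nat.sub_zero] at this
      exact le_trans (by exact_mod_cast this) (Nat.floor_le (Real.sqrt_nonneg x))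
    have h5 : ((S.filter fun m : ℕ => ¬ (m : ℝ) ≤ √x).card : ℝ) ≤
        2 / Real.log x * ∑ m ∈ S, Real.log m := by
      rw [Finset.mul_sum]
      calc _ = ∑ m ∈ S.filter fun m : ℕ => ¬ (m : ℝ) ≤ √x, (1 : ℝ) := by simp
        _ ≤ ∑ m ∈ S.filter fun m : ℕ => ¬ (m : ℝ) ≤ √x, 2 / Real.log x * Real.log m := by
            refine Finset.sum_le_sum fun m hm => ?_
            have hm' := (Finset.mem_filter.1 hm).2
            have h6 : Real.log √x ≤ Real.log m :=
              Real.log_le_log (Real.sqrt_pos.2 hx0) (not_le.1 hm').le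
            rw [Real.log_sqrt hx0.le] at h6
            rw [div_mul_eq_mul_div, le_div_iff₀ hL]
            linarith
        _ ≤ _ := by
            refine Finset.sum_le_sum_of_subset_of_nonneg (Finset.filter_subset _ _) fun m _ _ => ?_
            have := Real.log_natCast_nonneg m
            positivity
    have h6 := Finset.card_filter_add_card_filter_not (s := S) (fun m : ℕ => (m : ℝ) ≤ √x)
    have h7 : (S.card : ℝ) = (S.filter fun m : ℕ => (m : ℝ) ≤ √x).card +
        (S.filter fun m : ℕ => ¬ (m : ℝ) ≤ √x).card := by exact_mod_cast h6.symm
    linarith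
  have h8 : 2 / Real.log x * ∑ m ∈ S, Real.log m ≤ 16 * (x * Real.exp η * E) := by
    calc _ ≤ 2 / Real.log x * (Real.log x * (8 * x * Real.exp η * E)) := by gcongr
      _ = _ := by field_simp; ring
  have h9 : 16 * (x * Real.exp η * E) ≤ c * (x * Real.exp η * E) := by
    have : 0 < E := Real.exp_pos _
    gcongr
    exact le_max_left _ _
  calc _ ≤ √x + c * (x * Real.exp η * E) := by linarith
    _ = _ := by ring

/-! ### The cone of nonnegative combinations -/

theorem completelyMultiplicative_mul (a : ℕ → ℝ) {m n : ℕ} (hm : m ≠ 0) (hn : n ≠ 0) :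
    completelyMultiplicative a (m * n) =
      completelyMultiplicative a m * completelyMultiplicative a n := by
  rw [completelyMultiplicative, Nat.factorization_mul hm hn]
  exact Finsupp.prod_add_index' (fun _ => pow_zero _) fun _ _ _ => pow_add _ _ _

theorem completelyMultiplicative_prime (a : ℕ → ℝ) {p : ℕ} (hp : p.Prime) :
    completelyMultiplicative a p = a p := by
  rw [completelyMultiplicative, hp.factorization]
  exact (Finsupp.prod_single_index (h := fun p k => a p ^ k) (pow_zero _)).trans (pow_one _)

theorem abs_completelyMultiplicative {a : ℕ → ℝ} (ha : ∀ p, p.Prime → a p = 1 ∨ a p = -1) (n : ℕ) :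
    |completelyMultiplicative a n| = 1 := by
  rw [completelyMultiplicative, Finsupp.prod, Finset.abs_prod]
  refine Finset.prod_eq_one fun p hp => ?_
  rcases ha p (Nat.prime_of_mem_primeFactors hp) with h | h <;> simp [h]

/-- The cone of random variables spanned by the values of the random multiplicative function. -/
def multiplicativeCone {Ω : Type*} (ε : ℕ → Ω → ℝ) : AddSubmonoid (Ω → ℝ) :=
  AddSubmonoid.closure {X | ∃ c : ℝ, 0 ≤ c ∧ ∃ n : ℕ, n ≠ 0 ∧
    X = fun ω => c * completelyMultiplicative (fun p => ε p ω) n}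

namespace multiplicativeCone

variable {Ω : Type*} {ε : ℕ → Ω → ℝ}

theorem smul_mem {c : ℝ} (hc : 0 ≤ c) {n : ℕ} (hn : n ≠ 0) :
    (fun ω => c * completelyMultiplicative (fun p => ε p ω) n) ∈ multiplicativeCone ε :=
  AddSubmonoid.subset_closure ⟨c, hc, n, hn, rfl⟩

theorem one_mem : (1 : Ω → ℝ) ∈ multiplicativeCone ε := by
  have := smul_mem (ε := ε) zero_le_one one_ne_zero
  convert this using 1
  ext ω
  simp [completelyMultiplicative]

theorem mul_mem {X Y : Ω → ℝ} (hX : X ∈ multiplicativeCone ε) (hY : Y ∈ multiplicativeCone ε) :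
    X * Y ∈ multiplicativeCone ε := by
  induction hX using AddSubmonoid.closure_induction with
  | zero => rw [zero_mul]; exact zero_mem _
  | add X X' _ _ h h' => rw [add_mul]; exact add_mem h h'
  | mem X hX =>
    obtain ⟨c, hc, n, hn, rfl⟩ := hX
    induction hY using AddSubmonoid.closure_induction with
    | zero => rw [mul_zero]; exact zero_mem _
    | add Y Y' _ _ h h' => rw [mul_add]; exact add_mem h h'
    | mem Y hY =>
      obtain ⟨d, hd, m, hm, rfl⟩ := hY
      convert smul_mem (ε := ε) (mul_nonneg hc hd) (mul_ne_zero hn hm) using 1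
      ext ω
      rw [completelyMultiplicative_mul _ hn hm, Pi.mul_apply]
      ring

theorem pow_mem {X : Ω → ℝ} (hX : X ∈ multiplicativeCone ε) (q : ℕ) :
    X ^ q ∈ multiplicativeCone ε := by
  induction q with
  | zero => rw [pow_zero]; exact one_mem
  | succ q ih => rw [pow_succ]; exact mul_mem ih hX

/-- The cone is closed under sums and products, so every term of (X+Y)^q other than X^q stays in it.
Nonnegativity of expectations on the cone then makes moments monotone. -/
theorem add_pow_sub_pow_mem {X Y : Ω → ℝ} (hX : X ∈ multiplicativeCone ε)
    (hY : Y ∈ multiplicativeCone ε) (q : ℕ) : (X + Y) ^ q - X ^ q ∈ multiplicativeCone ε := by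
  induction q with
  | zero => rw [pow_zero, pow_zero, sub_self]; exact zero_mem _
  | succ q ih =>
    have : (X + Y) ^ (q + 1) - X ^ (q + 1) = ((X + Y) ^ q - X ^ q) * (X + Y) + X ^ q * Y := by ring
    rw [this]
    exact add_mem (mul_mem ih (add_mem hX hY)) (mul_mem (pow_mem hX q) hY)

end multiplicativeCone

/-! ### Moments of sums over integers with a large prime factor -/

namespace IsRademacherOnPrimes

variable {Ω : Type*} [MeasurableSpace Ω] {μ : Measure Ω} {ε : ℕ → Ω → ℝ}

theorem measurable_completelyMultiplicative (hε : IsRademacherOnPrimes μ ε) (n : ℕ) :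
    Measurable fun ω => completelyMultiplicative (fun p => ε p ω) n := by
  unfold completelyMultiplicative Finsupp.prod
  exact Finset.measurable_prod _ fun p hp =>
    (hε.measurable p (Nat.prime_of_mem_primeFactors hp)).pow_const _

variable [IsProbabilityMeasure μ]

theorem ae_eq_one_or (hε : IsRademacherOnPrimes μ ε) :
    ∀ᵐ ω ∂μ, ∀ p : ℕ, p.Prime → ε p ω = 1 ∨ ε p ω = -1 := by
  rw [ae_all_iff]
  intro p
  by_cases hp : p.Prime
  swap
  · exact Filter.Eventually.of_forall fun _ h => absurd h hp
  have hm := hε.measurable p hp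
  have h1 : MeasurableSet {ω | ε p ω = 1} := hm (measurableSet_singleton 1)
  have h2 : MeasurableSet {ω | ε p ω = -1} := hm (measurableSet_singleton (-1))
  have h3 : μ ({ω | ε p ω = 1} ∪ {ω | ε p ω = -1}) = 1 := by
    rw [measure_union _ h2, hε.prob_one p hp, hε.prob_neg_one p hp, ENNReal.add_halves]
    rw [Set.disjoint_left]
    intro ω (h : ε p ω = 1) (h' : ε p ω = -1)
    norm_num [h] at h'
  have h4 := (prob_compl_eq_zero_iff (h1.union h2)).2 h3
  filter_upwards [compl_mem_ae_iff.2 h4] with ω hω _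
  exact not_not.1 hω

theorem integral_comp (hε : IsRademacherOnPrimes μ ε) {p : ℕ} (hp : p.Prime) (g : ℝ → ℝ) :
    ∫ ω, g (ε p ω) ∂μ = (g 1 + g (-1)) / 2 := by
  have hm := hε.measurable p hp
  have h1 : MeasurableSet {ω | ε p ω = 1} := hm (measurableSet_singleton 1)
  have h2 : MeasurableSet {ω | ε p ω = -1} := hm (measurableSet_singleton (-1))
  have h : (fun ω => g (ε p ω)) =ᵐ[μ] fun ω =>
      {ω | ε p ω = 1}.indicator (fun _ => g 1) ω + {ω | ε p ω = -1}.indicator (fun _ => g (-1)) ω := by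
    filter_upwards [hε.ae_eq_one_or] with ω hω
    rcases hω p hp with h | h <;> simp [Set.indicator, h] <;> norm_num
  rw [integral_congr_ae h, integral_add, integral_indicator_const _ h1, integral_indicator_const _ h2,
    measureReal_def, measureReal_def, hε.prob_one p hp, hε.prob_neg_one p hp]
  · simp; ring
  · exact (integrable_const _).indicator h1
  · exact (integrable_const _).indicator h2

theorem integral_prod_comp (hε : IsRademacherOnPrimes μ ε) {s : Finset ℕ}
    (hs : ∀ p ∈ s, p.Prime) {g : ℕ → ℝ → ℝ} (hg : ∀ p, Measurable (g p)) :
    ∫ ω, ∏ p ∈ s, g p (ε p ω) ∂μ = ∏ p ∈ s, (g p 1 + g p (-1)) / 2 := by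
  have hind : iIndepFun (fun p : s => ε (p : ℕ)) μ :=
    hε.indep.precomp (g := fun p : s => (⟨p, hs p p.2⟩ : Nat.Primes)) fun a b hab =>
      Subtype.ext (congrArg (fun p : Nat.Primes => (p : ℕ)) hab)
  have h := hind.integral_fun_prod_comp (f := fun p : s => g p)
    (fun p => (hε.measurable p (hs p p.2)).aemeasurable)
    (fun p => (hg p).aestronglyMeasurable)
  calc _ = ∫ ω, ∏ p : s, g p (ε p ω) ∂μ := by
        congr 1; ext ω; exact (Finset.prod_coe_sort s fun p => g p (ε p ω)).symm
    _ = ∏ p : s, (g p 1 + g p (-1)) / 2 := by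
        rw [h]
        exact Finset.prod_congr rfl fun p _ => hε.integral_comp (hs p p.2) (g p)
    _ = _ := Finset.prod_coe_sort s fun p => (g p 1 + g p (-1)) / 2

theorem integrable_completelyMultiplicative (hε : IsRademacherOnPrimes μ ε) (n : ℕ) :
    Integrable (fun ω => completelyMultiplicative (fun p => ε p ω) n) μ := by
  refine Integrable.of_bound (hε.measurable_completelyMultiplicative n).aestronglyMeasurable 1 ?_
  filter_upwards [hε.ae_eq_one_or] with ω hω
  exact (abs_completelyMultiplicative hω n).le

/-- By independence the expectation factors over primes, an even exponent contributing 1 and an odd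
one 0. -/
theorem integral_completelyMultiplicative_nonneg (hε : IsRademacherOnPrimes μ ε) (n : ℕ) :
    0 ≤ ∫ ω, completelyMultiplicative (fun p => ε p ω) n ∂μ := by
  have h := hε.integral_prod_comp (s := n.primeFactors) (g := fun p x => x ^ n.factorization p)
    (fun p hp => Nat.prime_of_mem_primeFactors hp) fun p => by fun_prop
  refine h.symm ▸ ?_
  refine Finset.prod_nonneg fun p _ => ?_
  rcases neg_one_pow_eq_or ℝ (n.factorization p) with h | h <;> simp [h]

theorem integrable_of_mem_cone (hε : IsRademacherOnPrimes μ ε) {X : Ω → ℝ}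
    (hX : X ∈ multiplicativeCone ε) : Integrable X μ := by
  induction hX using AddSubmonoid.closure_induction with
  | zero => exact integrable_zero _ _ _
  | add X X' _ _ h h' => exact h.add h'
  | mem X hX =>
    obtain ⟨c, hc, n, hn, rfl⟩ := hX
    exact (hε.integrable_completelyMultiplicative n).const_mul c

theorem integral_nonneg_of_mem_cone (hε : IsRademacherOnPrimes μ ε) {X : Ω → ℝ}
    (hX : X ∈ multiplicativeCone ε) : 0 ≤ ∫ ω, X ω ∂μ := by
  induction hX using AddSubmonoid.closure_induction with
  | zero => simp
  | add X X' hX hX' h h' =>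
    simp only [Pi.add_apply]
    rw [integral_add (hε.integrable_of_mem_cone hX) (hε.integrable_of_mem_cone hX')]
    exact add_nonneg h h'
  | mem X hX =>
    obtain ⟨c, hc, n, hn, rfl⟩ := hX
    rw [integral_const_mul]
    exact mul_nonneg hc (hε.integral_completelyMultiplicative_nonneg n)

theorem integral_pow_le_integral_add_pow (hε : IsRademacherOnPrimes μ ε) {X Y : Ω → ℝ}
    (hX : X ∈ multiplicativeCone ε) (hY : Y ∈ multiplicativeCone ε) (q : ℕ) :
    ∫ ω, X ω ^ q ∂μ ≤ ∫ ω, (X ω + Y ω) ^ q ∂μ := by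
  have h := hε.integral_nonneg_of_mem_cone (multiplicativeCone.add_pow_sub_pow_mem hX hY q)
  have h2 := integral_sub (hε.integrable_of_mem_cone (multiplicativeCone.pow_mem (add_mem hX hY) q))
    (hε.integrable_of_mem_cone (multiplicativeCone.pow_mem hX q))
  simp only [Pi.sub_apply, Pi.pow_apply, Pi.add_apply] at h h2
  linarith

/-- Even moments of weighted sums of the independent signs. -/
theorem integral_sum_div_pow_le (hε : IsRademacherOnPrimes μ ε) {s : Finset ℕ}
    (hs : ∀ p ∈ s, p.Prime) {q : ℕ} (hq : Even q) {t : ℝ} (ht : 0 < t) :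
    ∫ ω, (∑ p ∈ s, ε p ω / p) ^ q ∂μ ≤
      2 * (q.factorial / t ^ q) * Real.exp (t ^ 2 * (∑ p ∈ s, 1 / (p : ℝ) ^ 2) / 2) := by
  have hmeas : Measurable fun ω => ∑ p ∈ s, ε p ω / p :=
    Finset.measurable_sum _ fun p hp => (hε.measurable p (hs p hp)).div_const _
  have hmgf : ∀ u : ℝ, ∫ ω, Real.exp (u * ∑ p ∈ s, ε p ω / p) ∂μ ≤
      Real.exp (u ^ 2 * (∑ p ∈ s, 1 / (p : ℝ) ^ 2) / 2) := by
    intro u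
    have h1 : ∀ ω, Real.exp (u * ∑ p ∈ s, ε p ω / p) = ∏ p ∈ s, Real.exp (u / p * ε p ω) := by
      intro ω
      rw [← Real.exp_sum, Finset.mul_sum]
      congr 1
      exact Finset.sum_congr rfl fun p _ => by ring
    simp only [h1]
    rw [hε.integral_prod_comp hs (g := fun p x => Real.exp (u / p * x)) fun p => by fun_prop]
    calc _ ≤ ∏ p ∈ s, Real.exp ((u / p) ^ 2 / 2) := by
          refine Finset.prod_le_prod (fun p _ => by positivity) fun p _ => ?_
          have := Real.cosh_le_exp_half_sq (u / p)
          rw [Real.cosh_eq] at this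
          simpa using this
      _ = _ := by
          rw [← Real.exp_sum]
          congr 1
          rw [Finset.mul_sum, Finset.sum_div]
          exact Finset.sum_congr rfl fun p _ => by ring
  have hint : ∀ u : ℝ, Integrable (fun ω => Real.exp (u * ∑ p ∈ s, ε p ω / p)) μ := by
    intro u
    refine Integrable.of_bound (hmeas.const_mul u).exp.aestronglyMeasurable (Real.exp (|u| * ∑ p ∈ s, 1 / (p : ℝ))) ?_
    filter_upwards [hε.ae_eq_one_or] with ω hω
    rw [Real.norm_of_nonneg (Real.exp_pos _).le]
    refine Real.exp_le_exp.2 ((le_abs_self _).trans ?_)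
    rw [abs_mul]
    gcongr
    refine (Finset.abs_sum_le_sum_abs _ _).trans (Finset.sum_le_sum fun p hp => ?_)
    rcases hω p (hs p hp) with h | h <;> simp [h, abs_div]
  -- One term of the exponential series: |tA|^q / q! ≤ exp|tA| ≤ exp(tA) + exp(-tA).
  have hpt : ∀ ω, (∑ p ∈ s, ε p ω / p) ^ q ≤ q.factorial / t ^ q *
      (Real.exp (t * ∑ p ∈ s, ε p ω / p) + Real.exp (-t * ∑ p ∈ s, ε p ω / p)) := by
    intro ω
    set A := ∑ p ∈ s, ε p ω / p
    have h1 := Real.pow_div_factorial_le_exp |t * A| (abs_nonneg _) q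
    rw [hq.pow_abs, mul_pow] at h1
    have h2 : Real.exp |t * A| ≤ Real.exp (t * A) + Real.exp (-t * A) := by
      rcases abs_cases (t * A) with h | h
      · rw [h.1]; linarith [Real.exp_pos (-t * A)]
      · rw [h.1, neg_mul]; linarith [Real.exp_pos (t * A)]
    have h3 := h1.trans h2
    have hf : (0 : ℝ) < q.factorial := by exact_mod_cast q.factorial_pos
    calc A ^ q = q.factorial / t ^ q * (t ^ q * A ^ q / q.factorial) := by field_simp
      _ ≤ _ := by gcongr
  calc _ ≤ ∫ ω, q.factorial / t ^ q *
        (Real.exp (t * ∑ p ∈ s, ε p ω / p) + Real.exp (-t * ∑ p ∈ s, ε p ω / p)) ∂μ := by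
        refine integral_mono_of_nonneg (Filter.Eventually.of_forall fun ω => hq.pow_nonneg _)
          (((hint t).add (hint (-t))).const_mul _) (Filter.Eventually.of_forall hpt)
    _ ≤ q.factorial / t ^ q * (Real.exp (t ^ 2 * (∑ p ∈ s, 1 / (p : ℝ) ^ 2) / 2) +
        Real.exp (t ^ 2 * (∑ p ∈ s, 1 / (p : ℝ) ^ 2) / 2)) := by
        rw [integral_const_mul, integral_add (hint t) (hint (-t))]
        have h1 := hmgf t
        have h2 := hmgf (-t)
        rw [neg_sq] at h2
        gcongr
    _ = _ := by ring

/-- Comparison of the sum over integers with a large prime factor with a product of a sum over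
primes and a sum over integers. -/
theorem integral_sum_not_smooth_pow_le (hε : IsRademacherOnPrimes μ ε) (M N q : ℕ) :
    ∫ ω, (∑ n ∈ (Finset.Icc 1 N).filter (· ∉ M.smoothNumbers),
        completelyMultiplicative (fun p => ε p ω) n) ^ q ∂μ ≤
      ∫ ω, (N * (∑ p ∈ (Finset.Icc M N).filter Nat.Prime, ε p ω / p) *
        ∑ m ∈ Finset.Icc 1 N, completelyMultiplicative (fun p => ε p ω) m / m) ^ q ∂μ := by
  classical
  set R := (Finset.Icc 1 N).filter (· ∉ M.smoothNumbers)
  set s := (Finset.Icc M N).filter Nat.Prime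
  set F : ℕ → Ω → ℝ := fun n ω => completelyMultiplicative (fun p => ε p ω) n
  have hex : ∀ n ∈ R, ∃ p, p.Prime ∧ p ∣ n ∧ M ≤ p := by
    intro n hn
    have := (Finset.mem_filter.1 hn).2
    rw [Nat.mem_smoothNumbers'] at this
    push Not at this
    exact this
  choose! P hP using hex
  have hR : ∀ n ∈ R, 1 ≤ n ∧ n ≤ N := fun n hn => Finset.mem_Icc.1 (Finset.mem_filter.1 hn).1
  -- Choosing a single prime factor P n ≥ M for each n makes n ↦ (P n, n / P n) injective, so each n
  -- uses up exactly one term of the expanded product.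
  set φ : ℕ → ℕ × ℕ := fun n => (P n, n / P n)
  have hφmul : ∀ n ∈ R, (φ n).1 * (φ n).2 = n := fun n hn => Nat.mul_div_cancel' (hP n hn).2.1
  have hφinj : Set.InjOn φ R := fun a ha b hb hab => by
    rw [← hφmul a ha, ← hφmul b hb, hab]
  have hφmem : R.image φ ⊆ s ×ˢ Finset.Icc 1 N := by
    intro x hx
    obtain ⟨n, hn, rfl⟩ := Finset.mem_image.1 hx
    have h1 := hP n hn
    have h2 := hR n hn
    have h3 := Nat.le_of_dvd h2.1 h1.2.1
    rw [Finset.mem_product, Finset.mem_filter, Finset.mem_Icc, Finset.mem_Icc]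
    exact ⟨⟨⟨h1.2.2, h3.trans h2.2⟩, h1.1⟩, Nat.div_pos h3 h1.1.pos,
      (Nat.div_le_self _ _).trans h2.2⟩
  set h : ℕ × ℕ → Ω → ℝ := fun x ω => (N / ((x.1 * x.2 : ℕ) : ℝ)) * F (x.1 * x.2) ω
  have hXmem : ∑ n ∈ R, F n ∈ multiplicativeCone ε := by
    refine sum_mem fun n hn => ?_
    have := multiplicativeCone.smul_mem (ε := ε) zero_le_one
      (Nat.one_le_iff_ne_zero.1 (hR n hn).1)
    simpa only [one_mul] using this
  -- The excess of the product over the original sum: the unused pairs, and the surplus weight N/n -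
  -- 1 ≥ 0 on the used ones.
  have hYmem : (∑ x ∈ (s ×ˢ Finset.Icc 1 N) \ R.image φ, h x +
      ∑ n ∈ R, fun ω => (N / (n : ℝ) - 1) * F n ω) ∈ multiplicativeCone ε := by
    refine add_mem (sum_mem fun x hx => ?_) (sum_mem fun n hn => ?_)
    · have hx' := (Finset.mem_sdiff.1 hx).1
      rw [Finset.mem_product, Finset.mem_filter, Finset.mem_Icc, Finset.mem_Icc] at hx'
      exact multiplicativeCone.smul_mem (by positivity)
        (mul_ne_zero hx'.1.2.ne_zero (Nat.one_le_iff_ne_zero.1 hx'.2.1))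
    · refine multiplicativeCone.smul_mem ?_ (Nat.one_le_iff_ne_zero.1 (hR n hn).1)
      have h1 : (1 : ℝ) ≤ n := by exact_mod_cast (hR n hn).1
      have h2 : (n : ℝ) ≤ N := by exact_mod_cast (hR n hn).2
      rw [sub_nonneg, le_div_iff₀ (by linarith)]
      linarith
  have hsum : ∀ ω, (∑ n ∈ R, F n) ω + (∑ x ∈ (s ×ˢ Finset.Icc 1 N) \ R.image φ, h x +
      ∑ n ∈ R, fun ω => (N / (n : ℝ) - 1) * F n ω) ω =
      N * (∑ p ∈ s, ε p ω / p) * ∑ m ∈ Finset.Icc 1 N, F m ω / m := by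
    intro ω
    have e1 : N * (∑ p ∈ s, ε p ω / p) * ∑ m ∈ Finset.Icc 1 N, F m ω / m =
        ∑ x ∈ s ×ˢ Finset.Icc 1 N, h x ω := by
      rw [mul_assoc, Finset.sum_mul_sum, Finset.mul_sum, Finset.sum_product]
      refine Finset.sum_congr rfl fun p hp => ?_
      rw [Finset.mul_sum]
      refine Finset.sum_congr rfl fun m hm => ?_
      have hp' := (Finset.mem_filter.1 hp).2
      have hm' := (Finset.mem_Icc.1 hm).1
      simp only [h, F]
      rw [completelyMultiplicative_mul _ hp'.ne_zero (by omega), completelyMultiplicative_prime _ hp']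
      push_cast
      have : (p : ℝ) ≠ 0 := by exact_mod_cast hp'.ne_zero
      have : (m : ℝ) ≠ 0 := by exact_mod_cast (by omega : m ≠ 0)
      field_simp
    have e2 : ∑ x ∈ R.image φ, h x ω = ∑ n ∈ R, (N / (n : ℝ)) * F n ω := by
      rw [Finset.sum_image hφinj]
      refine Finset.sum_congr rfl fun n hn => ?_
      simp only [h]
      rw [hφmul n hn]
    rw [e1, ← Finset.sum_sdiff hφmem, e2]
    simp only [Pi.add_apply, Finset.sum_apply, sub_mul, one_mul, Finset.sum_sub_distrib]
    ring
  have := hε.integral_pow_le_integral_add_pow hXmem hYmem q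
  simp only [hsum] at this
  simpa only [Finset.sum_apply] using this

theorem integral_sum_not_smooth_pow_le_of_pos (hε : IsRademacherOnPrimes μ ε) {M N q : ℕ}
    (hM : 2 ≤ M) (hN : 1 ≤ N) (hq : Even q) :
    ∫ ω, (∑ n ∈ (Finset.Icc 1 N).filter (· ∉ M.smoothNumbers),
        completelyMultiplicative (fun p => ε p ω) n) ^ q ∂μ ≤
      2 * (N * (1 + Real.log N) * (Real.exp 1 * √((q : ℝ) / M))) ^ q := by
  rcases Nat.eq_zero_or_pos q with rfl | hq0
  · simp
  have hM0 : (0 : ℝ) < M := by exact_mod_cast (by omega : 0 < M)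
  have hN1 : (1 : ℝ) ≤ N := by exact_mod_cast hN
  have hlN := Real.log_nonneg hN1
  have hq' : (0 : ℝ) < q := by exact_mod_cast hq0
  set s := (Finset.Icc M N).filter Nat.Prime
  have hs : ∀ p ∈ s, p.Prime := fun p hp => (Finset.mem_filter.1 hp).2
  have hV : ∑ p ∈ s, 1 / (p : ℝ) ^ 2 ≤ (2 : ℝ) / M := by
    -- The maximum only keeps the interval meaningful when N < M; the telescoped bound 1/(M-1) does
    -- not depend on it.
    calc _ ≤ ∑ p ∈ Finset.Ioc (M - 1) (max M (N + 1)), ((p : ℝ) ^ 2)⁻¹ := by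
          simp only [one_div]
          refine Finset.sum_le_sum_of_subset_of_nonneg ?_ fun _ _ _ => by positivity
          intro p hp
          have := Finset.mem_Icc.1 (Finset.mem_filter.1 hp).1
          rw [Finset.mem_Ioc]
          have := le_max_right M (N + 1)
          omega
      _ ≤ ((M - 1 : ℕ) : ℝ)⁻¹ - ((max M (N + 1) : ℕ) : ℝ)⁻¹ :=
          sum_Ioc_inv_sq_le_sub (by omega) (by have := le_max_left M (N + 1); omega)
      _ ≤ ((M - 1 : ℕ) : ℝ)⁻¹ := sub_le_self _ (by positivity)
      _ ≤ 2 / M := by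
          have h2 : (2 : ℝ) ≤ M := by exact_mod_cast hM
          rw [Nat.cast_sub (by omega), Nat.cast_one, inv_eq_one_div,
            div_le_div_iff₀ (by linarith) hM0]
          linarith
  have hA : ∫ ω, (∑ p ∈ s, ε p ω / p) ^ q ∂μ ≤ 2 * (Real.exp 1 * √((q : ℝ) / M)) ^ q := by
    -- The choice t = √(qM) balances the two factors: the Gaussian exponent is at most q, while q! /
    -- t^q ≤ √(q/M)^q.
    have ht : 0 < √((q : ℝ) * M) := Real.sqrt_pos.2 (by positivity)
    refine (hε.integral_sum_div_pow_le hs hq ht).trans ?_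
    have h1 : √((q : ℝ) * M) ^ 2 * (∑ p ∈ s, 1 / (p : ℝ) ^ 2) / 2 ≤ q := by
      rw [Real.sq_sqrt (by positivity)]
      calc _ ≤ (q * M : ℝ) * (2 / M) / 2 := by gcongr
        _ = q := by field_simp
    have h2 : (q.factorial : ℝ) ≤ (q : ℝ) ^ q := by exact_mod_cast q.factorial_le_pow
    have h3 : (q : ℝ) / √((q : ℝ) * M) = √((q : ℝ) / M) := by
      rw [Real.sqrt_mul hq'.le, Real.sqrt_div hq'.le, div_eq_div_iff (by positivity) (by positivity)]
      rw [← mul_assoc, Real.mul_self_sqrt hq'.le]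
    calc _ ≤ 2 * ((q : ℝ) ^ q / √((q : ℝ) * M) ^ q) * Real.exp q := by gcongr
      _ = _ := by
        rw [← div_pow, h3, mul_pow, ← Real.exp_nat_mul, mul_one]; ring
  have hB : ∀ᵐ ω ∂μ, |∑ m ∈ Finset.Icc 1 N, completelyMultiplicative (fun p => ε p ω) m / m| ≤
      1 + Real.log N := by
    filter_upwards [hε.ae_eq_one_or] with ω hω
    calc _ ≤ ∑ m ∈ Finset.Icc 1 N, ((m : ℝ))⁻¹ := by
          refine (Finset.abs_sum_le_sum_abs _ _).trans (Finset.sum_le_sum fun m _ => ?_)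
          rw [abs_div, abs_completelyMultiplicative hω, Nat.abs_cast, one_div]
      _ = (harmonic N : ℝ) := by rw [harmonic_eq_sum_Icc]; push_cast; rfl
      _ ≤ _ := harmonic_le_one_add_log N
  have hAint : Integrable (fun ω => (∑ p ∈ s, ε p ω / p) ^ q) μ := by
    have hmeas : Measurable fun ω => ∑ p ∈ s, ε p ω / p :=
      Finset.measurable_sum _ fun p hp => (hε.measurable p (hs p hp)).div_const _
    refine Integrable.of_bound (hmeas.pow_const q).aestronglyMeasurable ((∑ p ∈ s, 1 / (p : ℝ)) ^ q) ?_
    filter_upwards [hε.ae_eq_one_or] with ω hω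
    rw [norm_pow]
    gcongr
    refine (Finset.abs_sum_le_sum_abs _ _).trans (Finset.sum_le_sum fun p hp => ?_)
    rcases hω p (hs p hp) with h | h <;> simp [h, abs_div]
  calc _ ≤ _ := hε.integral_sum_not_smooth_pow_le M N q
    _ ≤ ∫ ω, (N * (1 + Real.log N)) ^ q * (∑ p ∈ s, ε p ω / p) ^ q ∂μ := by
        refine integral_mono_of_nonneg (Filter.Eventually.of_forall fun ω => hq.pow_nonneg _)
          (hAint.const_mul _) ?_
        filter_upwards [hB] with ω hω
        rw [mul_right_comm, mul_pow]
        refine mul_le_mul_of_nonneg_right ?_ (hq.pow_nonneg _)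
        rw [← hq.pow_abs]
        rw [abs_mul, Nat.abs_cast]
        gcongr
    _ ≤ (N * (1 + Real.log N)) ^ q * (2 * (Real.exp 1 * √((q : ℝ) / M)) ^ q) := by
        rw [integral_const_mul]
        gcongr
    _ = _ := by rw [mul_pow _ (Real.exp 1 * √((q : ℝ) / M))]; ring

end IsRademacherOnPrimes

/-! ### Parameters for the smooth count -/

theorem eventually_mul_pow_le_exp (A : ℝ) (n : ℕ) :
    ∀ᶠ u : ℝ in Filter.atTop, A * u ^ n ≤ Real.exp u := by
  have h := (Real.isLittleO_pow_exp_atTop (n := n)).bound (show (0 : ℝ) < (|A| + 1)⁻¹ by positivity)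
  filter_upwards [h, Filter.eventually_ge_atTop 0] with u hu hu0
  rw [Real.norm_of_nonneg (by positivity), Real.norm_of_nonneg (Real.exp_pos u).le,
    inv_mul_eq_div, le_div_iff₀ (by positivity)] at hu
  have : A * u ^ n ≤ (|A| + 1) * u ^ n := by
    gcongr; linarith [le_abs_self A]
  linarith

/-- The smoothness threshold used to split the partial sum up to `x`. -/
noncomputable def smoothnessThreshold (C x : ℝ) : ℕ :=
  ⌈Real.exp (Real.log x * Real.log (Real.log (Real.log x)) / (C * Real.log (Real.log x))) *
    Real.log x ^ (2 * C + 8)⌉₊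

/-- With a as the main part of log M, L/a = Cℓ/m, so η = m + 1 saves Cℓ + Cℓ/m. Since exp(η)/η ≤
3ℓ/m, the second saving pays for the Euler product and leaves ℓ/m over. The 1 covers the effect of
the lower-order part b of log M. -/
theorem neg_mul_div_add_le {c C L l m η ℓ : ℝ} (hc : 1 ≤ c) (hC : 3 * c + 2 ≤ C) (hm : 1 ≤ m)
    (hℓ : ℓ = Real.exp m) (hη : η = m + 1) (hL0 : 0 < L) (hl0 : 0 < l)
    (hL : 2 * (2 * C + 9) * C ^ 2 * ℓ ^ 3 ≤ L)
    (hl : l ≤ L * m / (C * ℓ) + (2 * C + 9) * ℓ) :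
    -(η * (L / l)) + c * (Real.exp η / η) ≤ 1 - C * ℓ - ℓ / m := by
  have hm0 : 0 < m := by linarith
  have hC0 : 0 < C := by linarith
  have hℓ0 : 0 < ℓ := hℓ ▸ Real.exp_pos m
  have hη0 : 0 < η := by linarith
  set a := L * m / (C * ℓ) with ha
  set b := (2 * C + 9) * ℓ with hb
  have ha0 : 0 < a := by positivity
  have hb0 : 0 < b := by positivity
  have h1 : L / a - L * b / a ^ 2 ≤ L / l := by
    calc L / a - L * b / a ^ 2 ≤ L / (a + b) := by
          rw [le_div_iff₀ (by positivity)]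
          have : (L / a - L * b / a ^ 2) * (a + b) = L - L * b ^ 2 / a ^ 2 := by field_simp; ring
          rw [this]
          linarith [show 0 ≤ L * b ^ 2 / a ^ 2 by positivity]
      _ ≤ L / l := by gcongr
  have h2 : L / a = C * ℓ / m := by rw [ha]; field_simp
  have h3 : η * (L * b / a ^ 2) ≤ 1 := by
    have e1 : η * (L * b / a ^ 2) = η * ((2 * C + 9) * C ^ 2 * ℓ ^ 3) / (L * m ^ 2) := by
      rw [ha, hb]; field_simp
    rw [e1, div_le_one (by positivity)]
    calc η * ((2 * C + 9) * C ^ 2 * ℓ ^ 3) ≤ (2 * m ^ 2) * ((2 * C + 9) * C ^ 2 * ℓ ^ 3) := by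
          gcongr
          nlinarith
      _ = (2 * (2 * C + 9) * C ^ 2 * ℓ ^ 3) * m ^ 2 := by ring
      _ ≤ L * m ^ 2 := by gcongr
  have h4 : Real.exp η / η ≤ 3 * (ℓ / m) := by
    have e1 : Real.exp η = ℓ * Real.exp 1 := by rw [hη, Real.exp_add, hℓ]
    have e2 := Real.exp_one_lt_d9
    rw [e1, mul_div_assoc', div_le_div_iff₀ hη0 hm0]
    have : Real.exp 1 * m ≤ 3 * η := by nlinarith
    nlinarith
  have h5 : η * (L / a - L * b / a ^ 2) ≤ η * (L / l) := by gcongr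
  have h6 : η * (L / a) = C * ℓ + C * (ℓ / m) := by rw [h2, hη]; field_simp
  have h7 : 0 < ℓ / m := by positivity
  have h8 : c * (Real.exp η / η) ≤ c * (3 * (ℓ / m)) := by gcongr
  have h9 : (3 * c + 2) * (ℓ / m) ≤ C * (ℓ / m) := by gcongr
  rw [mul_sub] at h5
  linarith

/-- Rounding up at most multiplies by exp(ℓ), whence 2C + 9 in place of 2C + 8. -/
theorem log_ceil_exp_bounds {C a ℓ : ℝ} (hC : 1 ≤ C) (ha : 0 ≤ a) (hℓ : 1 ≤ ℓ) :
    3 ≤ ⌈Real.exp (a + (2 * C + 8) * ℓ)⌉₊ ∧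
      a ≤ Real.log ⌈Real.exp (a + (2 * C + 8) * ℓ)⌉₊ ∧
      Real.log ⌈Real.exp (a + (2 * C + 8) * ℓ)⌉₊ ≤ a + (2 * C + 9) * ℓ := by
  set t := a + (2 * C + 8) * ℓ with ht
  have h8 : 8 * 1 ≤ (2 * C + 8) * ℓ := by gcongr; linarith
  have hz8 : 8 ≤ Real.exp t := by linarith [Real.add_one_le_exp t]
  have hzM := Nat.le_ceil (Real.exp t)
  have hM0 : (0 : ℝ) < ⌈Real.exp t⌉₊ := by linarith
  refine ⟨?_, ?_, ?_⟩
  · have : (3 : ℝ) ≤ ⌈Real.exp t⌉₊ := by linarith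
    exact_mod_cast this
  · rw [Real.le_log_iff_exp_le hM0]
    exact (Real.exp_le_exp.2 (by linarith)).trans hzM
  · rw [Real.log_le_iff_le_exp hM0]
    have e1 := (Nat.ceil_lt_add_one (Real.exp_pos t).le).le
    have e2 : Real.exp (a + (2 * C + 9) * ℓ) = Real.exp t * Real.exp ℓ := by
      rw [← Real.exp_add, ht]; ring_nf
    have e3 : 2 ≤ Real.exp ℓ := by linarith [Real.add_one_le_exp ℓ]
    rw [e2]
    nlinarith

theorem sqrt_exp_le {C ℓ L : ℝ} (hℓ : 1 ≤ ℓ) (hL : C * ℓ ≤ L / 10 - 4 * ℓ) (hL0 : 40 ≤ L) :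
    √(Real.exp L) ≤ Real.exp L * Real.exp (-(C * ℓ)) / 8 := by
  have e2 : 8 ≤ Real.exp (L / 2 - C * ℓ) := by
    linarith [Real.add_one_le_exp (L / 2 - C * ℓ)]
  have e3 : Real.exp L * Real.exp (-(C * ℓ)) = Real.exp (L / 2) * Real.exp (L / 2 - C * ℓ) := by
    rw [← Real.exp_add, ← Real.exp_add]; ring_nf
  rw [← Real.exp_half, e3]
  nlinarith [Real.exp_pos (L / 2)]

/-- The surplus exp(-ℓ/m) beats exp(m) = ℓ and any constant, since ℓ/m ≥ 72c + m. Here 72 = 8 · 9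
with 9 bounding e². -/
theorem mul_exp_mul_exp_le {c C m ℓ x : ℝ} (hc : 1 ≤ c) (hx : 0 ≤ x) (hm : 1 ≤ m)
    (hℓ : ℓ = Real.exp m) (h : (72 * c + 1) * m ^ 2 ≤ ℓ) :
    c * x * Real.exp (m + 1) * Real.exp (1 - C * ℓ - ℓ / m) ≤ x * Real.exp (-(C * ℓ)) / 8 := by
  have hm0 : 0 < m := by linarith
  have hℓ0 : 0 < ℓ := hℓ ▸ Real.exp_pos m
  have e1 : 72 * c * ℓ ≤ Real.exp (ℓ / m) := by
    have e2 : 72 * c + m ≤ ℓ / m := by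
      rw [le_div_iff₀ hm0]
      nlinarith [mul_nonneg (by linarith : 0 ≤ c) (mul_nonneg hm0.le (sub_nonneg.2 hm))]
    calc 72 * c * ℓ ≤ Real.exp (72 * c) * Real.exp m := by
          rw [← hℓ]
          gcongr
          linarith [Real.add_one_le_exp (72 * c)]
      _ = Real.exp (72 * c + m) := (Real.exp_add _ _).symm
      _ ≤ _ := Real.exp_le_exp.2 e2
  have e3 := Real.exp_one_lt_d9
  have e4 : Real.exp 1 * Real.exp 1 ≤ 9 := by nlinarith [Real.exp_pos 1]
  calc _ = x * Real.exp (-(C * ℓ)) * (c * ℓ * (Real.exp 1 * Real.exp 1) / Real.exp (ℓ / m)) := by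
        rw [Real.exp_add, ← hℓ, show 1 - C * ℓ - ℓ / m = 1 + -(C * ℓ) + -(ℓ / m) by ring,
          Real.exp_add, Real.exp_add, Real.exp_neg (ℓ / m)]
        field_simp
    _ ≤ x * Real.exp (-(C * ℓ)) * (1 / 8) := by
        gcongr ?_ * ?_
        rw [div_le_div_iff₀ (Real.exp_pos _) (by norm_num)]
        have : c * ℓ * (Real.exp 1 * Real.exp 1) ≤ c * ℓ * 9 := by gcongr
        linarith
    _ = _ := by ring

theorem eventually_card_smooth_le :
    ∃ C₀ : ℝ, 0 < C₀ ∧ ∀ C : ℝ, C₀ ≤ C → ∀ᶠ x : ℝ in Filter.atTop,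
      2 ≤ smoothnessThreshold C x ∧
      (((Finset.Icc 1 ⌊x⌋₊).filter (· ∈ (smoothnessThreshold C x).smoothNumbers)).card : ℝ) ≤
        x / Real.log x ^ C / 4 := by
  obtain ⟨c, hc, hcard⟩ := card_smooth_le
  refine ⟨3 * c + 2, by linarith, fun C hC => ?_⟩
  have hC0 : 0 < C := by linarith
  have t1 := Real.tendsto_log_atTop
  have t2 := t1.comp t1
  have t3 := t1.comp t2
  have ev1 := t2.eventually
    (eventually_mul_pow_le_exp (2 * (2 * C + 9) * C ^ 2 + 10 * C + 40) 3)
  have ev2 := t3.eventually (eventually_mul_pow_le_exp (72 * c + 1) 2)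
  filter_upwards [ev1, ev2, t3.eventually (Filter.eventually_ge_atTop 1),
    t2.eventually (Filter.eventually_ge_atTop 1), t1.eventually (Filter.eventually_ge_atTop 1),
    Filter.eventually_gt_atTop 1] with x h1 h2 hm hℓ1 hL1 hx1
  simp only [Function.comp_apply] at h1 h2 hm hℓ1 hL1
  have hx0 : 0 < x := by linarith
  rw [smoothnessThreshold]
  rw [Real.exp_log (by linarith)] at h1
  rw [Real.exp_log (by linarith)] at h2
  have hLe : Real.log x = Real.exp (Real.log (Real.log x)) := (Real.exp_log (by linarith)).symm
  have hℓe : Real.log (Real.log x) = Real.exp (Real.log (Real.log (Real.log x))) :=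
    (Real.exp_log (by linarith)).symm
  have hxe : x = Real.exp (Real.log x) := (Real.exp_log (by linarith)).symm
  have hcard := hcard ⌈Real.exp (Real.log x * Real.log (Real.log (Real.log x)) /
    (C * Real.log (Real.log x))) * Real.log x ^ (2 * C + 8)⌉₊ x
  -- From here the iterated logarithms are free variables, tied only by x = exp L, L = exp ℓ and ℓ =
  -- exp m.
  generalize Real.log (Real.log (Real.log x)) = m at *
  generalize Real.log (Real.log x) = ℓ at *
  generalize Real.log x = L at *
  have hL0 : 0 < L := by linarith
  have hℓ0 : 0 < ℓ := by linarith
  have hm0 : 0 < m := by linarith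
  have hmℓ : m ≤ ℓ := by rw [hℓe]; linarith [Real.add_one_le_exp m]
  have hℓ3 : ℓ ≤ ℓ ^ 3 := le_self_pow₀ hℓ1 (by norm_num)
  have hpow : ∀ u : ℝ, L ^ u = Real.exp (u * ℓ) := fun u => by
    rw [Real.rpow_def_of_pos hL0, mul_comm]
    conv_lhs => rw [hLe, Real.log_exp]
  have hbig0 : 0 ≤ 2 * (2 * C + 9) * C ^ 2 * ℓ ^ 3 := by positivity
  have hbig2 : (10 * C + 40) * ℓ ≤ L := by
    have : (10 * C + 40) * ℓ ≤ (10 * C + 40) * ℓ ^ 3 := by gcongr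
    linarith
  have hbig1 : 2 * (2 * C + 9) * C ^ 2 * ℓ ^ 3 ≤ L := by
    have : 0 ≤ (10 * C + 40) * ℓ ^ 3 := by positivity
    linarith
  have hbig3 : C * ℓ ≤ L / 10 - 4 * ℓ := by linarith
  have hCℓ : 0 < C * ℓ := by positivity
  have ha0 : 0 < L * m / (C * ℓ) := by positivity
  rw [hpow, ← Real.exp_add] at hcard ⊢
  obtain ⟨hM3, hlge, hlle⟩ := log_ceil_exp_bounds (by linarith) ha0.le hℓ1 (C := C)
  generalize ⌈Real.exp (L * m / (C * ℓ) + (2 * C + 8) * ℓ)⌉₊ = M at *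
  have hM0 : (0 : ℝ) < M := by exact_mod_cast (by omega : 0 < M)
  refine ⟨by omega, ?_⟩
  have hMx : (M : ℝ) ≤ x := by
    rw [hxe, ← Real.log_le_iff_le_exp hM0]
    have e1 : L * m / (C * ℓ) ≤ L / 5 := by
      rw [div_le_div_iff₀ hCℓ (by norm_num), mul_assoc]
      have : m * 5 ≤ C * ℓ := by nlinarith
      gcongr
    linarith
  have hη : 4 * (m + 1) ≤ Real.log M := by
    refine le_trans ?_ hlge
    rw [le_div_iff₀ hCℓ]
    calc 4 * (m + 1) * (C * ℓ) ≤ (8 * m) * (C * ℓ) := by gcongr ?_ * _; linarith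
      _ = (8 * (C * ℓ)) * m := by ring
      _ ≤ L * m := by gcongr ?_ * _; linarith
  have hexp := neg_mul_div_add_le (L := L) (l := Real.log M) hc hC hm hℓe rfl hL0
    (by linarith) hbig1 hlle
  have hmain := hcard (m + 1) hM3 hMx (by linarith) hη
  have hsecond := mul_exp_mul_exp_le (C := C) hc hx0.le hm hℓe h2
  have hthird : c * x * Real.exp (m + 1) *
      Real.exp (-((m + 1) * (L / Real.log M)) + c * (Real.exp (m + 1) / (m + 1))) ≤
      c * x * Real.exp (m + 1) * Real.exp (1 - C * ℓ - ℓ / m) := by gcongr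
  have hsqrt := sqrt_exp_le hℓ1 hbig3 (by nlinarith)
  rw [← hxe] at hsqrt
  rw [hpow, div_eq_mul_inv x, ← Real.exp_neg]
  linarith

/-! ### Splitting the partial sum and conclusion -/

namespace IsRademacherOnPrimes

variable {Ω : Type*} [MeasurableSpace Ω] {μ : Measure Ω} [IsProbabilityMeasure μ] {ε : ℕ → Ω → ℝ}

theorem ae_abs_sum_le_card (hε : IsRademacherOnPrimes μ ε) (s : Finset ℕ) :
    ∀ᵐ ω ∂μ, |∑ n ∈ s, completelyMultiplicative (fun p => ε p ω) n| ≤ s.card := by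
  filter_upwards [hε.ae_eq_one_or] with ω hω
  refine (Finset.abs_sum_le_sum_abs _ _).trans (le_of_eq ?_)
  simp [abs_completelyMultiplicative hω]

theorem integral_sum_pow_le_card_pow (hε : IsRademacherOnPrimes μ ε) (s : Finset ℕ) {q : ℕ}
    (hq : Even q) :
    ∫ ω, (∑ n ∈ s, completelyMultiplicative (fun p => ε p ω) n) ^ q ∂μ ≤ (s.card : ℝ) ^ q := by
  calc _ ≤ ∫ _, (s.card : ℝ) ^ q ∂μ := by
        refine integral_mono_of_nonneg (Filter.Eventually.of_forall fun ω => hq.pow_nonneg _)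
          (integrable_const _) ?_
        filter_upwards [hε.ae_abs_sum_le_card s] with ω hω
        rw [← hq.pow_abs]
        gcongr
    _ = _ := by simp

theorem integral_randomPartialSum_pow_le (hε : IsRademacherOnPrimes μ ε) {x : ℝ} (hx : 0 ≤ x)
    {q : ℕ} (hq : Even q) : ∫ ω, randomPartialSum ε x ω ^ q ∂μ ≤ x ^ q := by
  refine (hε.integral_sum_pow_le_card_pow _ hq).trans ?_
  rw [Nat.card_Icc, Nat.add_sub_cancel]
  gcongr
  exact Nat.floor_le hx

theorem integrable_sum_pow (hε : IsRademacherOnPrimes μ ε) {s : Finset ℕ} (hs : ∀ n ∈ s, n ≠ 0)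
    (q : ℕ) :
    Integrable (fun ω => (∑ n ∈ s, completelyMultiplicative (fun p => ε p ω) n) ^ q) μ := by
  have h : ∑ n ∈ s, (fun ω => completelyMultiplicative (fun p => ε p ω) n) ∈
      multiplicativeCone ε := by
    refine sum_mem fun n hn => ?_
    have := multiplicativeCone.smul_mem (ε := ε) zero_le_one (hs n hn)
    simpa only [one_mul] using this
  have := hε.integrable_of_mem_cone (multiplicativeCone.pow_mem h q)
  convert this using 1
  ext ω
  simp

theorem integral_randomPartialSum_pow_le_add (hε : IsRademacherOnPrimes μ ε) {x : ℝ} (hx : 1 ≤ x)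
    {M q : ℕ} (hM : 2 ≤ M) (hq : Even q) :
    ∫ ω, randomPartialSum ε x ω ^ q ∂μ ≤
      2 ^ q * ((((Finset.Icc 1 ⌊x⌋₊).filter (· ∈ M.smoothNumbers)).card : ℝ) ^ q +
        2 * (x * (1 + Real.log x) * (Real.exp 1 * √((q : ℝ) / M))) ^ q) := by
  set N := ⌊x⌋₊
  have hN : 1 ≤ N := Nat.one_le_floor_iff x |>.2 hx
  have hNx : (N : ℝ) ≤ x := Nat.floor_le (by linarith)
  have hN1 : (1 : ℝ) ≤ N := by exact_mod_cast hN
  have hne : ∀ n ∈ Finset.Icc 1 N, n ≠ 0 := fun n hn => by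
    have := (Finset.mem_Icc.1 hn).1; omega
  have hi1 := hε.integrable_sum_pow (s := (Finset.Icc 1 N).filter (· ∈ M.smoothNumbers))
    (fun n hn => hne n (Finset.mem_filter.1 hn).1) q
  have hi2 := hε.integrable_sum_pow (s := (Finset.Icc 1 N).filter (· ∉ M.smoothNumbers))
    (fun n hn => hne n (Finset.mem_filter.1 hn).1) q
  have h2 := hε.integral_sum_not_smooth_pow_le_of_pos hM hN hq
  have h1 := hε.integral_sum_pow_le_card_pow
    ((Finset.Icc 1 N).filter (· ∈ M.smoothNumbers)) hq
  calc _ ≤ ∫ ω, 2 ^ q * ((∑ n ∈ (Finset.Icc 1 N).filter (· ∈ M.smoothNumbers),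
          completelyMultiplicative (fun p => ε p ω) n) ^ q +
        (∑ n ∈ (Finset.Icc 1 N).filter (· ∉ M.smoothNumbers),
          completelyMultiplicative (fun p => ε p ω) n) ^ q) ∂μ := by
        refine integral_mono_of_nonneg (Filter.Eventually.of_forall fun ω => hq.pow_nonneg _)
          ((hi1.add hi2).const_mul _) (Filter.Eventually.of_forall fun ω => ?_)
        simp only [randomPartialSum]
        rw [← Finset.sum_filter_add_sum_filter_not _ (· ∈ M.smoothNumbers)]
        refine hq.add_pow_le.trans ?_
        refine mul_le_mul_of_nonneg_right (pow_le_pow_right₀ (by norm_num) (Nat.sub_le _ _)) ?_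
        exact add_nonneg (hq.pow_nonneg _) (hq.pow_nonneg _)
    _ ≤ 2 ^ q * ((((Finset.Icc 1 N).filter (· ∈ M.smoothNumbers)).card : ℝ) ^ q +
        2 * (N * (1 + Real.log N) * (Real.exp 1 * √((q : ℝ) / M))) ^ q) := by
        rw [integral_const_mul, integral_add hi1 hi2]
        gcongr
    _ ≤ _ := by
        have := Real.log_nonneg hN1
        gcongr

end IsRademacherOnPrimes

/-- For such large q, q exp(-a) ≥ (log x)/2, so the exponential alone compensates for y^(q/2) ≤
x^(q/2). -/
theorem le_first_term {x y C : ℝ} {q : ℕ} (hx : 1 < x) (hy : 0 < y) (hyx : y ≤ x)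
    (hℓ : 0 ≤ Real.log (Real.log x))
    (hq : Real.log x / 2 * Real.exp (Real.log x * Real.log (Real.log (Real.log x)) /
      (C * Real.log (Real.log x))) ≤ q) :
    x ^ q ≤ x ^ q / y ^ ((q : ℝ) / 2) *
      Real.exp (q * (q * Real.exp (-(Real.log x * Real.log (Real.log (Real.log x)) /
        (C * Real.log (Real.log x)))) + 2 * Real.log (Real.log x))) := by
  have hx0 : 0 < x := by linarith
  set a := Real.log x * Real.log (Real.log (Real.log x)) / (C * Real.log (Real.log x))
  have h1 : Real.log x / 2 ≤ q * Real.exp (-a) := by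
    rw [Real.exp_neg, ← div_eq_mul_inv, le_div_iff₀ (Real.exp_pos a)]; exact hq
  have h2 : y ^ ((q : ℝ) / 2) ≤
      Real.exp (q * (q * Real.exp (-a) + 2 * Real.log (Real.log x))) := by
    calc y ^ ((q : ℝ) / 2) ≤ x ^ ((q : ℝ) / 2) := Real.rpow_le_rpow hy.le hyx (by positivity)
      _ = Real.exp (q * (Real.log x / 2)) := by rw [Real.rpow_def_of_pos hx0]; ring_nf
      _ ≤ _ := by
          refine Real.exp_le_exp.2 (mul_le_mul_of_nonneg_left ?_ (Nat.cast_nonneg q))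
          linarith
  have hy' : 0 < y ^ ((q : ℝ) / 2) := by positivity
  rw [div_mul_eq_mul_div, le_div_iff₀ hy']
  gcongr

/-- The power 2C + 8 in the threshold gives √(q/M) ≤ L^(-C-3). Two of the three spare powers of L
remain after the factor 1 + L, and 6/L² ≤ 1/4 once L ≥ 5. -/
theorem log_mul_sqrt_div_smoothnessThreshold_le {C x : ℝ} {q : ℕ} (hL : 5 ≤ Real.log x)
    (hq : q < Real.log x / 2 * Real.exp (Real.log x * Real.log (Real.log (Real.log x)) /
      (C * Real.log (Real.log x)))) :
    (1 + Real.log x) * (Real.exp 1 * √((q : ℝ) / smoothnessThreshold C x)) ≤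
      1 / Real.log x ^ C / 4 := by
  rw [smoothnessThreshold]
  set a := Real.log x * Real.log (Real.log (Real.log x)) / (C * Real.log (Real.log x))
  set L := Real.log x
  have hL0 : 0 < L := by linarith
  have hLC : 0 < L ^ C := by positivity
  have h1 : (q : ℝ) / ⌈Real.exp a * L ^ (2 * C + 8)⌉₊ ≤ (1 / (L ^ C * L ^ 3)) ^ 2 := by
    have e1 : L ^ (2 * C + 8) = (L ^ C) ^ 2 * L ^ 8 := by
      rw [Real.rpow_add hL0, mul_comm 2 C, Real.rpow_mul hL0.le]
      norm_cast
    calc _ ≤ (L / 2 * Real.exp a) / (Real.exp a * L ^ (2 * C + 8)) := by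
          gcongr
          exact Nat.le_ceil _
      _ = 1 / ((L ^ C) ^ 2 * L ^ 6) * (1 / (2 * L)) := by rw [e1]; field_simp
      _ ≤ 1 / ((L ^ C) ^ 2 * L ^ 6) * 1 := by
          gcongr
          rw [div_le_one (by positivity)]; linarith
      _ = _ := by field_simp
  have h2 : √((q : ℝ) / ⌈Real.exp a * L ^ (2 * C + 8)⌉₊) ≤ 1 / (L ^ C * L ^ 3) :=
    Real.sqrt_le_iff.2 ⟨by positivity, h1⟩
  have h3 := Real.exp_one_lt_d9
  calc _ ≤ (2 * L) * (3 * (1 / (L ^ C * L ^ 3))) := by gcongr <;> linarith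
    _ = 1 / L ^ C * (6 / L ^ 2) := by field_simp; norm_num
    _ ≤ 1 / L ^ C * (1 / 4) := by
        gcongr ?_ * ?_
        rw [div_le_div_iff₀ (by positivity) (by norm_num)]
        nlinarith
    _ = _ := by ring

theorem one_lt_log_and_one_lt_log_log {x : ℝ} (hx : Real.exp (Real.exp 1) < x) :
    1 < Real.log (Real.log x) ∧ 1 < Real.log x := by
  have hx0 : 0 < x := (Real.exp_pos _).trans hx
  have h1 : Real.exp 1 < Real.log x := (Real.lt_log_iff_exp_lt hx0).2 hx
  have h2 : 1 < Real.exp 1 := by linarith [Real.add_one_lt_exp (one_ne_zero (α := ℝ))]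
  exact ⟨(Real.lt_log_iff_exp_lt (by linarith)).2 h1, by linarith⟩

theorem proposition5p2 :
    ∃ C₀ : ℝ, 0 < C₀ ∧ ∀ C : ℝ, C₀ ≤ C → ∃ K : ℝ, 0 < K ∧
      ∀ (Ω : Type*) [MeasurableSpace Ω] (μ : Measure Ω) [IsProbabilityMeasure μ]
        (ε : ℕ → Ω → ℝ), IsRademacherOnPrimes μ ε →
      ∀ x y : ℝ, Real.exp (Real.exp 1) < x → 0 < y → y ≤ x →
      ∀ q : ℕ, Even q →
        ∫ ω, randomPartialSum ε x ω ^ q ∂μ ≤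
          K * (x ^ q / y ^ ((q : ℝ) / 2) *
                Real.exp (q * (q * Real.exp (-(Real.log x * Real.log (Real.log (Real.log x)) /
                    (C * Real.log (Real.log x)))) + 2 * Real.log (Real.log x))) +
              (x / Real.log x ^ C) ^ q) := by
  obtain ⟨C₁, hC₁, hsmooth⟩ := eventually_card_smooth_le
  refine ⟨max C₁ 1, by positivity, fun C hC => ?_⟩
  have hC1 : 1 ≤ C := (le_max_right _ _).trans hC
  obtain ⟨x₀, hx₀⟩ := Filter.eventually_atTop.1 ((hsmooth C ((le_max_left _ _).trans hC)).and
    (Real.tendsto_log_atTop.eventually (Filter.eventually_ge_atTop 5)))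
  set L₀ := max 1 (Real.log x₀)
  have hL₀ : 1 ≤ L₀ := le_max_left _ _
  -- The 3 comes from the three moment terms in the splitting for large x. The other value handles x
  -- < x₀, where q ≤ L₀ exp(L₀) and the lost factor is at most (L₀^C)^q.
  refine ⟨max 3 ((L₀ ^ C) ^ (L₀ * Real.exp L₀)), by positivity, ?_⟩
  intro Ω _ μ _ ε hε x y hx hy hyx q hq
  set K := max 3 ((L₀ ^ C) ^ (L₀ * Real.exp L₀))
  have hK3 : 3 ≤ K := le_max_left _ _
  obtain ⟨hℓ, hL⟩ := one_lt_log_and_one_lt_log_log hx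
  have hx0 : 0 < x := (Real.exp_pos _).trans hx
  have hx1 : 1 < x := (Real.log_pos_iff hx0.le).1 (by linarith)
  have hL0 : 0 < Real.log x := by linarith
  set T := x ^ q / y ^ ((q : ℝ) / 2) *
    Real.exp (q * (q * Real.exp (-(Real.log x * Real.log (Real.log (Real.log x)) /
      (C * Real.log (Real.log x)))) + 2 * Real.log (Real.log x))) with hT
  have hT0 : 0 ≤ T := by positivity
  have hU0 : 0 ≤ (x / Real.log x ^ C) ^ q := by positivity
  rcases le_or_gt (Real.log x / 2 * Real.exp (Real.log x * Real.log (Real.log (Real.log x)) /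
      (C * Real.log (Real.log x)))) q with hqa | hqa
  · have h1 := (hε.integral_randomPartialSum_pow_le hx0.le hq).trans
      (le_first_term hx1 hy hyx (by linarith) hqa)
    rw [← hT] at h1
    nlinarith
  suffices h : ∫ ω, randomPartialSum ε x ω ^ q ∂μ ≤ K * (x / Real.log x ^ C) ^ q by
    refine h.trans ?_
    gcongr
    linarith
  rcases le_or_gt x₀ x with hxx | hxx
  · obtain ⟨⟨hM, hcard⟩, hL5⟩ := hx₀ x hxx
    have h1 := log_mul_sqrt_div_smoothnessThreshold_le hL5 hqa
    have h2 : x * (1 + Real.log x) * (Real.exp 1 * √((q : ℝ) / smoothnessThreshold C x)) ≤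
        x / Real.log x ^ C / 4 := by
      calc _ = x * ((1 + Real.log x) * (Real.exp 1 * √((q : ℝ) / smoothnessThreshold C x))) := by
            ring
        _ ≤ x * (1 / Real.log x ^ C / 4) := by gcongr
        _ = _ := by ring
    refine (hε.integral_randomPartialSum_pow_le_add hx1.le hM hq).trans ?_
    set U := x / Real.log x ^ C
    have hU : 0 ≤ U := by positivity
    -- Both parts are at most U/4, so the factor 2^q from splitting the q-th power is harmless.
    calc _ ≤ 2 ^ q * ((U / 4) ^ q + 2 * (U / 4) ^ q) := by gcongr
      _ = 3 * (U / 2) ^ q := by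
          rw [show U / 2 = 2 * (U / 4) by ring, mul_pow 2 (U / 4)]; ring
      _ ≤ K * U ^ q := by
          gcongr
          linarith
  · have hLL : Real.log x ≤ L₀ := (Real.log_le_log hx0 hxx.le).trans (le_max_right _ _)
    have hq2 : (q : ℝ) ≤ L₀ * Real.exp L₀ := by
      refine hqa.le.trans ?_
      have hm : Real.log (Real.log (Real.log x)) ≤ C * Real.log (Real.log x) := by
        have := Real.log_le_sub_one_of_pos (show 0 < Real.log (Real.log x) by linarith)
        nlinarith
      have h1 : Real.log x * Real.log (Real.log (Real.log x)) / (C * Real.log (Real.log x)) ≤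
          L₀ := by
        rw [div_le_iff₀ (by positivity)]
        have hm0 : 0 ≤ Real.log (Real.log (Real.log x)) := Real.log_nonneg hℓ.le
        gcongr
      gcongr
      linarith
    refine (hε.integral_randomPartialSum_pow_le hx0.le hq).trans ?_
    have hLC : 0 < Real.log x ^ C := by positivity
    have hLL1 : 1 ≤ L₀ ^ C := Real.one_le_rpow hL₀ (by linarith)
    calc x ^ q = (Real.log x ^ C) ^ q * (x / Real.log x ^ C) ^ q := by
          rw [← mul_pow, mul_div_cancel₀ _ hLC.ne']
      _ ≤ K * (x / Real.log x ^ C) ^ q := by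
          gcongr
          refine le_trans ?_ (le_max_right _ _)
          calc (Real.log x ^ C) ^ q ≤ (L₀ ^ C) ^ q := by gcongr
            _ = (L₀ ^ C) ^ (q : ℝ) := (Real.rpow_natCast _ _).symm
            _ ≤ _ := Real.rpow_le_rpow_of_exponent_le hLL1 hq2
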